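/- Let $I\subseteq\mathbb{R}$ be an open interval (for instance $I=\mathbb{R}$), let $\mathtt v$ be continuously differentiable and positive on $I$, let $x_0\in I$, $\lambda>0$ and $T\in(0,\infty]$. Let $\{X(t)\}$, $0\le t<T$, be a random motion in $I$ with space-varying velocity $\mathtt v$: its paths are continuous with $X(0)=x_0$, the initial direction is rightwards or leftwards with probability $\frac12$ each, the direction is reversed at the events of a homogeneous Poisson process with intensity $\lambda$, independent of the initial direction, and at every time $t$ that is not a reversal $\frac{dX(t)}{dt}=+\mathtt v(X(t))$ or $-\mathtt v(X(t))$ according to whether the current direction is rightwards or leftwards. (A finite horizon $T$ is needed only if the motion can leave $I$ in finite time; otherwise one may take $T=\infty$.) For $0<t<T$ let $R_t$ be the support of the law of $X(t)$ and $\partial R_t$ its boundary. Then the following hold. 1. For $0<t<T$ the law of $X(t)$ restricted to $\mathbb{R}\setminus\partial R_t$ has a density $f(x,t)\ge 0$ with respect to Lebesgue measure which is continuous in $x\in\mathbb{R}\setminus\partial R_t$ (so it is uniquely determined there). 2. For every $0<t<T$ and every $x\notin\partial R_t$ (in particular for every $x\in\mathrm{Int}(R_t)$), the derivatives below exist in the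 classical sense and $$\frac{\partial^2 f}{\partial t^2}+2\lambda\frac{\partial f}{\partial t}=\frac{\partial}{\partial x}\left\{\mathtt v(x)\,\frac{\partial}{\partial x}\big[\mathtt v(x)\,f\big]\right\}.$$ 3. For every $c>0$, the process $\mathcal T(t)=c\int_{x_0}^{X(t)}\frac{dw}{\mathtt v(w)}$, $0\le t<T$, is a standard telegraph process with velocity $c$: it starts at $0$ and moves with constant velocity $\pm c$, with the same initial direction and the same Poisson reversals as $X$. -/

import Mathlib

open MeasureTheory ProbabilityTheory Set Filter Topology
open scoped NNReal ENNReal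

/-- `N` is a homogeneous Poisson process of intensity `lam`: a counting process started at `0`,
with nondecreasing right-continuous paths (hence càdlàg), independent increments, and increments
over `[s, t]` with the Poisson law of mean `lam * (t - s)`. -/
structure IsPoissonProcess {Ω : Type*} [MeasurableSpace Ω] (P : Measure Ω)
    (N : ℝ≥0 → Ω → ℕ) (lam : ℝ≥0) : Prop where
  measurable : ∀ t, Measurable (N t)
  start_zero : ∀ᵐ ω ∂P, N 0 ω = 0
  monotone_paths : ∀ᵐ ω ∂P, Monotone (fun t => N t ω)
  rightCont_paths : ∀ᵐ ω ∂P, ∀ t, ContinuousWithinAt (fun s => N s ω) (Ici t) t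
  indep_increments : HasIndepIncrements N P
  increments_law : ∀ s t, s ≤ t →
    P.map (fun ω => N t ω - N s ω) = poissonMeasure (lam * (t - s))

/-- The direction at time `t` (`1` is rightwards, `-1` is leftwards) of a motion with initial
direction `D₀` which reverses at each event of `N`. -/
def direction {Ω : Type*} (D₀ : Ω → ℝ) (N : ℝ≥0 → Ω → ℕ) (t : ℝ≥0) (ω : Ω) : ℝ :=
  D₀ ω * (-1) ^ N t ω

/-- `X` is, on the time interval `[0, T)`, the random motion in `I` with space-varying velocity
`v`, started at `x₀`, with initial direction `D₀` chosen with probability `1/2` each, and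
direction reversals at the events of the independent Poisson process `N` of intensity `lam`.
Paths are continuous and satisfy `dX/dt = ± v (X t)` at every time that is not a reversal. -/
structure IsSpaceVaryingMotion {Ω : Type*} [MeasurableSpace Ω] (P : Measure Ω)
    (I : Set ℝ) (v : ℝ → ℝ) (lam : ℝ≥0) (x₀ : ℝ) (T : ℝ≥0∞)
    (D₀ : Ω → ℝ) (N : ℝ≥0 → Ω → ℕ) (X : ℝ≥0 → Ω → ℝ) : Prop where
  measurable_dir : Measurable D₀
  dir_right : P {ω | D₀ ω = 1} = 1 / 2
  dir_left : P {ω | D₀ ω = -1} = 1 / 2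
  poisson : IsPoissonProcess P N lam
  indep : IndepFun D₀ (fun ω t => N t ω) P
  aemeasurable : ∀ t : ℝ≥0, (t : ℝ≥0∞) < T → AEMeasurable (X t) P
  start : ∀ᵐ ω ∂P, X 0 ω = x₀
  mem_space : ∀ᵐ ω ∂P, ∀ t : ℝ≥0, (t : ℝ≥0∞) < T → X t ω ∈ I
  continuous_paths : ∀ᵐ ω ∂P, ContinuousOn (fun t => X t ω) {t : ℝ≥0 | (t : ℝ≥0∞) < T}
  velocity : ∀ᵐ ω ∂P, ∀ t : ℝ≥0, 0 < t → (t : ℝ≥0∞) < T →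
    ContinuousAt (fun s => N s ω) t →
      HasDerivAt (fun s : ℝ => X s.toNNReal ω) (direction D₀ N t ω * v (X t ω)) (t : ℝ)

/-- A standard (symmetric) telegraph process on `[0, T)`: constant velocity `c`, started at `0`. -/
def IsTelegraphProcess {Ω : Type*} [MeasurableSpace Ω] (P : Measure Ω)
    (c : ℝ) (lam : ℝ≥0) (T : ℝ≥0∞)
    (D₀ : Ω → ℝ) (N : ℝ≥0 → Ω → ℕ) (Z : ℝ≥0 → Ω → ℝ) : Prop :=
  IsSpaceVaryingMotion P univ (fun _ => c) lam 0 T D₀ N Z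

/-- The support `R_t` of the law of `X t`. -/
def supportAt {Ω : Type*} [MeasurableSpace Ω] (P : Measure Ω) (X : ℝ≥0 → Ω → ℝ) (t : ℝ≥0) :
    Set ℝ :=
  (P.map (X t)).support

/-- `f x t` is the density of `X t` at `x`, for `0 < t < T`: off the boundary of the support `R_t`
(whose points may carry atoms) the law of `X t` has the nonnegative Lebesgue density `f · t`,
in the version that is continuous there. -/
structure IsDensityOf {Ω : Type*} [MeasurableSpace Ω] (P : Measure Ω) (X : ℝ≥0 → Ω → ℝ)
    (T : ℝ≥0∞) (f : ℝ → ℝ → ℝ) : Prop where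
  nonneg : ∀ t : ℝ≥0, 0 < t → (t : ℝ≥0∞) < T → ∀ x ∉ frontier (supportAt P X t), 0 ≤ f x t
  continuousOn : ∀ t : ℝ≥0, 0 < t → (t : ℝ≥0∞) < T →
    ContinuousOn (fun x => f x t) (frontier (supportAt P X t))ᶜ
  law : ∀ t : ℝ≥0, 0 < t → (t : ℝ≥0∞) < T →
    (P.map (X t)).restrict (frontier (supportAt P X t))ᶜ =
      (volume.restrict (frontier (supportAt P X t))ᶜ).withDensity
        (fun x => ENNReal.ofReal (f x t))

/-- At the point `(x, t)` all derivatives occurring in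
`f_tt + 2 lam f_t = ∂ₓ (v ∂ₓ (v f))` exist in the classical sense, and the equation holds. -/
structure SolvesVelocityPDEAt (v : ℝ → ℝ) (lam : ℝ) (f : ℝ → ℝ → ℝ) (x t : ℝ) : Prop where
  diff_t : DifferentiableAt ℝ (fun s => f x s) t
  diff_tt : DifferentiableAt ℝ (deriv (fun s => f x s)) t
  diff_x : DifferentiableAt ℝ (fun y => v y * f y t) x
  diff_xx : DifferentiableAt ℝ (fun y => v y * deriv (fun z => v z * f z t) y) x
  eqn : deriv (deriv (fun s => f x s)) t + 2 * lam * deriv (fun s => f x s) t =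
    deriv (fun y => v y * deriv (fun z => v z * f z t) y) x

open scoped Nat

theorem integral_pow_mul_sub_pow (a b : ℕ) (t : ℝ) :
    ∫ r in (0 : ℝ)..t, r ^ a * (t - r) ^ b =
      (a ! * b ! : ℝ) / ((a + b + 1)! : ℝ) * t ^ (a + b + 1) := by
  induction b generalizing a with
  | zero =>
    simp only [pow_zero, mul_one, integral_pow, Nat.factorial_zero, Nat.cast_one, add_zero]
    have h : ((a + 1)! : ℝ) = (a + 1) * a ! := by push_cast [Nat.factorial_succ]; ring
    have : (a ! : ℝ) ≠ 0 := by positivity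
    rw [h]
    field_simp
    simp
  | succ b ih =>
    have hu : ∀ r ∈ uIcc 0 t, HasDerivAt (fun r : ℝ => (t - r) ^ (b + 1))
        (-((b + 1) * (t - r) ^ b)) r := fun r _ => by
      have := ((hasDerivAt_id r).const_sub t).fun_pow (b + 1)
      simpa using this
    have hw : ∀ r ∈ uIcc 0 t, HasDerivAt (fun r : ℝ => r ^ (a + 1) / (a + 1)) (r ^ a) r :=
      fun r _ => by
        have := (hasDerivAt_pow (a + 1) r).div_const ((a : ℝ) + 1)
        refine this.congr_deriv ?_
        push_cast
        rw [mul_div_assoc]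
        exact mul_div_cancel₀ _ (by positivity)
    have key := intervalIntegral.integral_mul_deriv_eq_deriv_mul hu hw
      (by apply Continuous.intervalIntegrable; fun_prop)
      (by apply Continuous.intervalIntegrable; fun_prop)
    have e1 : ∀ r : ℝ, r ^ a * (t - r) ^ (b + 1) = (t - r) ^ (b + 1) * r ^ a := fun r => mul_comm _ _
    have e2 : ∀ r : ℝ, -((b + 1) * (t - r) ^ b) * (r ^ (a + 1) / (a + 1)) =
        -((b + 1) / (a + 1)) * (r ^ (a + 1) * (t - r) ^ b) := fun r => by ring
    simp only [e1, key, e2, intervalIntegral.integral_const_mul, ih]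
    have h1 : ((a + 1)! : ℝ) = (a + 1) * a ! := by push_cast [Nat.factorial_succ]; ring
    have h2 : ((b + 1)! : ℝ) = (b + 1) * b ! := by push_cast [Nat.factorial_succ]; ring
    rw [h1, h2, show a + 1 + b + 1 = a + (b + 1) + 1 by ring]
    have : ((a + (b + 1) + 1)! : ℝ) ≠ 0 := by positivity
    field_simp
    simp

theorem sum_ascending_factorial_div (m K : ℕ) :
    (m + 1 : ℝ) * ∑ k ∈ Finset.range (K + 1), ((m + k)! : ℝ) / k ! =
      ((m + 1 + K)! : ℝ) / K ! := by
  induction K with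
  | zero => simp [Nat.factorial_succ]
  | succ K ih =>
    rw [Finset.sum_range_succ, mul_add, ih]
    have h1 : ((K + 1)! : ℝ) = (K + 1) * K ! := by push_cast [Nat.factorial_succ]; ring
    have h2 : ((m + 1 + (K + 1))! : ℝ) = (m + 1 + (K + 1)) * (m + 1 + K)! := by
      rw [← add_assoc, Nat.factorial_succ]; push_cast; ring
    rw [h1, h2, show m + (K + 1) = m + 1 + K by ring]
    field_simp
    ring

/-- Finite measures concentrated on a compact interval are determined by their moments. -/
theorem measure_eq_of_moments_eq {μ ν : Measure ℝ} [IsFiniteMeasure μ] [IsFiniteMeasure ν]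
    {a b : ℝ} (hμ : μ (Icc a b)ᶜ = 0) (hν : ν (Icc a b)ᶜ = 0)
    (h : ∀ m : ℕ, ∫ x, x ^ m ∂μ = ∫ x, x ^ m ∂ν) : μ = ν := by
  have hint : ∀ (ρ : Measure ℝ) [IsFiniteMeasure ρ], ρ (Icc a b)ᶜ = 0 →
      ∀ g : ℝ → ℝ, Continuous g → Integrable g ρ := by
    intro ρ _ hρ g hg
    have : ρ = ρ.restrict (Icc a b) := (Measure.restrict_eq_self_of_ae_mem hρ).symm
    rw [this]
    exact hg.continuousOn.integrableOn_compact isCompact_Icc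
  have hpoly : ∀ p : Polynomial ℝ, ∫ x, p.eval x ∂μ = ∫ x, p.eval x ∂ν := by
    intro p
    simp only [Polynomial.eval_eq_sum_range]
    rw [integral_finsetSum _ fun i _ => hint μ hμ _ (by fun_prop),
      integral_finsetSum _ fun i _ => hint ν hν _ (by fun_prop)]
    simp only [integral_const_mul, h]
  apply ext_of_forall_integral_eq_of_IsFiniteMeasure
  intro f
  have bound : ∀ (ρ : Measure ℝ) [IsFiniteMeasure ρ], ρ (Icc a b)ᶜ = 0 → ∀ (p : Polynomial ℝ)
      (ε : ℝ), (∀ x ∈ Icc a b, |p.eval x - f x| < ε) →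
      |∫ x, p.eval x ∂ρ - ∫ x, f x ∂ρ| ≤ ε * ρ.real univ := by
    intro ρ _ hρ p ε hp
    rw [← integral_sub (hint ρ hρ _ p.continuous) (hint ρ hρ _ f.continuous), ← Real.norm_eq_abs]
    apply norm_integral_le_of_norm_le_const
    filter_upwards [show ∀ᵐ x ∂ρ, x ∈ Icc a b from hρ] with x hx using (hp x hx).le
  have key : ∀ ε > 0, |∫ x, f x ∂μ - ∫ x, f x ∂ν| ≤ ε * (μ.real univ + ν.real univ) := by
    intro ε hε
    obtain ⟨p, hp⟩ := exists_polynomial_near_of_continuousOn a b f f.continuous.continuousOn ε hε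
    have h1 := bound μ hμ p ε hp
    have h2 := bound ν hν p ε hp
    rw [hpoly p] at h1
    rw [abs_le] at *
    constructor <;> linarith
  have h0 : |∫ x, f x ∂μ - ∫ x, f x ∂ν| ≤ 0 := by
    have ht : Tendsto (fun ε : ℝ => ε * (μ.real univ + ν.real univ)) (𝓝[>] 0)
        (𝓝 (0 * (μ.real univ + ν.real univ))) :=
      (tendsto_id.mono_left nhdsWithin_le_nhds).mul_const _
    rw [zero_mul] at ht
    exact ge_of_tendsto ht (eventually_mem_nhdsWithin.mono key)
  exact sub_eq_zero.1 (abs_nonpos_iff.1 h0)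

/-- The entire function `∑ wᵏ / (k! (k + j)!)`, a rescaled modified Bessel function. -/
noncomputable def besselSeries (j : ℕ) (w : ℝ) : ℝ := ∑' k : ℕ, w ^ k / (k ! * (k + j)! : ℝ)

theorem summable_besselSeries (j : ℕ) (w : ℝ) :
    Summable fun k : ℕ => w ^ k / (k ! * (k + j)! : ℝ) := by
  refine Summable.of_norm_bounded (Real.summable_pow_div_factorial |w|) fun k => ?_
  rw [norm_div, norm_pow, Real.norm_eq_abs w, Real.norm_of_nonneg (by positivity)]
  gcongr
  exact le_mul_of_one_le_right (by positivity) (by exact_mod_cast Nat.one_le_iff_ne_zero.2 (Nat.factorial_ne_zero _))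

theorem hasSum_besselSeries (j : ℕ) (w : ℝ) :
    HasSum (fun k : ℕ => w ^ k / (k ! * (k + j)! : ℝ)) (besselSeries j w) :=
  (summable_besselSeries j w).hasSum

theorem hasDerivAt_besselSeries (j : ℕ) (w : ℝ) :
    HasDerivAt (besselSeries j) (besselSeries (j + 1) w) w := by
  have e : ∀ (k : ℕ) (y : ℝ), ((k + 1 : ℕ) : ℝ) * y ^ k / ((k + 1)! * (k + 1 + j)! : ℝ) =
      y ^ k / (k ! * (k + (j + 1))! : ℝ) := fun k y => by
    have h1 : ((k + 1)! : ℝ) = ((k + 1 : ℕ) : ℝ) * k ! := by push_cast [Nat.factorial_succ]; ring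
    rw [h1, show k + 1 + j = k + (j + 1) by ring, mul_assoc]
    rw [mul_div_mul_left _ _ (by positivity)]
  set R : ℝ := |w| + 1
  have hb : ∀ (k : ℕ) (y : ℝ), y ∈ Metric.ball (0 : ℝ) R →
      ‖(k : ℝ) * y ^ (k - 1) / (k ! * (k + j)! : ℝ)‖ ≤
        (k : ℝ) * R ^ (k - 1) / (k ! * (k + j)! : ℝ) := by
    intro k y hy
    have hy' : |y| ≤ R := by simpa using (mem_ball_zero_iff.1 hy).le
    rw [norm_div, norm_mul, norm_pow, Real.norm_eq_abs y, Real.norm_of_nonneg (by positivity),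
      Real.norm_of_nonneg (by positivity)]
    gcongr
  have hs : Summable fun k : ℕ => (k : ℝ) * R ^ (k - 1) / (k ! * (k + j)! : ℝ) := by
    rw [← summable_nat_add_iff 1]
    refine (summable_besselSeries (j + 1) R).congr fun k => ?_
    rw [← e]; simp
  have key := hasDerivAt_tsum_of_isPreconnected hs Metric.isOpen_ball
    (convex_ball (0 : ℝ) R).isPreconnected
    (g := fun (k : ℕ) (y : ℝ) => y ^ k / (k ! * (k + j)! : ℝ))
    (fun k y _ => (hasDerivAt_pow k y).div_const _) hb
    (Metric.mem_ball_self (by positivity)) (summable_besselSeries j 0)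
    (show w ∈ Metric.ball (0 : ℝ) R by simp [R])
  have hsum : HasSum (fun k : ℕ => (k : ℝ) * w ^ (k - 1) / (k ! * (k + j)! : ℝ))
      (besselSeries (j + 1) w) := by
    rw [← hasSum_nat_add_iff' 1]
    simp only [Finset.range_one, Finset.sum_singleton, Nat.cast_zero, zero_mul, zero_div, sub_zero,
      Nat.add_sub_cancel]
    refine (hasSum_besselSeries (j + 1) w).congr_fun fun k => ?_
    rw [e]
  rw [hsum.tsum_eq] at key
  exact key

theorem continuous_besselSeries (j : ℕ) : Continuous (besselSeries j) :=
  continuous_iff_continuousAt.2 fun w => (hasDerivAt_besselSeries j w).continuousAt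

theorem besselSeries_recurrence (j : ℕ) (w : ℝ) :
    w * besselSeries (j + 2) w + (j + 1) * besselSeries (j + 1) w = besselSeries j w := by
  have h1 : HasSum (fun k : ℕ => (k : ℝ) * (w ^ k / (k ! * (k + (j + 1))! : ℝ)))
      (w * besselSeries (j + 2) w) := by
    rw [← hasSum_nat_add_iff' 1]
    simp only [Finset.range_one, Finset.sum_singleton, Nat.cast_zero, zero_mul, sub_zero]
    refine ((hasSum_besselSeries (j + 2) w).mul_left w).congr_fun fun k => ?_
    have h1 : ((k + 1)! : ℝ) = ((k + 1 : ℕ) : ℝ) * k ! := by push_cast [Nat.factorial_succ]; ring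
    rw [h1, show k + 1 + (j + 1) = k + (j + 2) by ring, pow_succ]
    field_simp
  refine (h1.add ((hasSum_besselSeries (j + 1) w).mul_left ((j : ℝ) + 1))).unique ?_
  refine (hasSum_besselSeries j w).congr_fun fun k => ?_
  have h1 : ((k + (j + 1))! : ℝ) = (k + (j + 1)) * (k + j)! := by
    rw [← add_assoc, Nat.factorial_succ]; push_cast; ring
  rw [h1]
  have : (k + j + 1 : ℝ) ≠ 0 := by positivity
  field_simp

theorem besselSeries_pos (j : ℕ) {w : ℝ} (hw : 0 ≤ w) : 0 < besselSeries j w :=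
  (summable_besselSeries j w).tsum_pos (fun k => by positivity) 0 (by positivity)

/-- The absolutely continuous part of the law at time `t` of the telegraph process with unit
velocity and intensity `lam`, as a function of `z ∈ (-t, t)`. -/
noncomputable def telegraphDensity (lam z t : ℝ) : ℝ :=
  Real.exp (-lam * t) / 2 * (lam * besselSeries 0 (lam ^ 2 * (t ^ 2 - z ^ 2) / 4) +
    lam ^ 2 * t / 2 * besselSeries 1 (lam ^ 2 * (t ^ 2 - z ^ 2) / 4))

theorem telegraphDensity_pos {lam z t : ℝ} (hlam : 0 < lam) (ht : 0 < t) (hz : |z| ≤ t) :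
    0 < telegraphDensity lam z t := by
  have hw : 0 ≤ lam ^ 2 * (t ^ 2 - z ^ 2) / 4 := by
    have : z ^ 2 ≤ t ^ 2 := sq_le_sq.2 (by rwa [abs_of_pos ht])
    have := sub_nonneg.2 this
    positivity
  have := besselSeries_pos 0 hw
  have := besselSeries_pos 1 hw
  unfold telegraphDensity
  positivity

theorem continuous_telegraphDensity (lam t : ℝ) : Continuous fun z => telegraphDensity lam z t := by
  have h0 := continuous_besselSeries 0
  have h1 := continuous_besselSeries 1
  unfold telegraphDensity
  fun_prop

section Derivatives
variable (lam z t : ℝ)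

theorem hasDerivAt_besselSeries_time (j : ℕ) :
    HasDerivAt (fun s => besselSeries j (lam ^ 2 * (s ^ 2 - z ^ 2) / 4))
      (lam ^ 2 * t / 2 * besselSeries (j + 1) (lam ^ 2 * (t ^ 2 - z ^ 2) / 4)) t := by
  have h : HasDerivAt (fun s : ℝ => lam ^ 2 * (s ^ 2 - z ^ 2) / 4) (lam ^ 2 * t / 2) t := by
    have := (((hasDerivAt_pow 2 t).sub_const (z ^ 2)).const_mul (lam ^ 2)).div_const 4
    refine this.congr_deriv ?_
    push_cast
    ring
  have := (hasDerivAt_besselSeries j _).comp t h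
  rwa [mul_comm] at this

theorem hasDerivAt_besselSeries_space (j : ℕ) :
    HasDerivAt (fun y => besselSeries j (lam ^ 2 * (t ^ 2 - y ^ 2) / 4))
      (-(lam ^ 2 * z / 2) * besselSeries (j + 1) (lam ^ 2 * (t ^ 2 - z ^ 2) / 4)) z := by
  have h : HasDerivAt (fun y : ℝ => lam ^ 2 * (t ^ 2 - y ^ 2) / 4) (-(lam ^ 2 * z / 2)) z := by
    have := (((hasDerivAt_pow 2 z).const_sub (t ^ 2)).const_mul (lam ^ 2)).div_const 4
    refine this.congr_deriv ?_
    push_cast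
    ring
  have := (hasDerivAt_besselSeries j _).comp z h
  rwa [mul_comm] at this

/-- The time derivative of `telegraphDensity`. -/
noncomputable def telegraphDensityT : ℝ :=
  let B := fun j => besselSeries j (lam ^ 2 * (t ^ 2 - z ^ 2) / 4);
  -lam * telegraphDensity lam z t + Real.exp (-lam * t) / 2 *
    (lam * (lam ^ 2 * t / 2 * B 1) + (lam ^ 2 / 2 * B 1 + lam ^ 2 * t / 2 * (lam ^ 2 * t / 2 * B 2)))

/-- The second time derivative of `telegraphDensity`. -/
noncomputable def telegraphDensityTT : ℝ :=
  let B := fun j => besselSeries j (lam ^ 2 * (t ^ 2 - z ^ 2) / 4);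
  -lam * telegraphDensityT lam z t +
    (-lam * (telegraphDensityT lam z t + lam * telegraphDensity lam z t) +
    Real.exp (-lam * t) / 2 *
      (lam * (lam ^ 2 / 2 * B 1 + lam ^ 2 * t / 2 * (lam ^ 2 * t / 2 * B 2)) +
        (lam ^ 2 / 2 * (lam ^ 2 * t / 2 * B 2) + (lam ^ 4 * t / 2 * B 2 +
          lam ^ 4 * t ^ 2 / 4 * (lam ^ 2 * t / 2 * B 3)))))

/-- The space derivative of `telegraphDensity`. -/
noncomputable def telegraphDensityZ : ℝ :=
  let B := fun j => besselSeries j (lam ^ 2 * (t ^ 2 - z ^ 2) / 4)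
  Real.exp (-lam * t) / 2 * (lam * (-(lam ^ 2 * z / 2) * B 1) +
    lam ^ 2 * t / 2 * (-(lam ^ 2 * z / 2) * B 2))

/-- The second space derivative of `telegraphDensity`. -/
noncomputable def telegraphDensityZZ : ℝ :=
  let B := fun j => besselSeries j (lam ^ 2 * (t ^ 2 - z ^ 2) / 4)
  Real.exp (-lam * t) / 2 *
    (lam * (-(lam ^ 2 / 2) * B 1 + -(lam ^ 2 * z / 2) * (-(lam ^ 2 * z / 2) * B 2)) +
    lam ^ 2 * t / 2 * (-(lam ^ 2 / 2) * B 2 + -(lam ^ 2 * z / 2) * (-(lam ^ 2 * z / 2) * B 3)))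

theorem hasDerivAt_exp_neg_mul_half : HasDerivAt (fun s => Real.exp (-lam * s) / 2)
    (-lam * (Real.exp (-lam * t) / 2)) t := by
  have := (((hasDerivAt_id t).const_mul (-lam)).exp).div_const 2
  refine this.congr_deriv ?_
  simp only [id]
  ring

theorem hasDerivAt_telegraphDensity_time :
    HasDerivAt (fun s => telegraphDensity lam z s) (telegraphDensityT lam z t) t := by
  have h0 := hasDerivAt_besselSeries_time lam z t 0
  have h1 := hasDerivAt_besselSeries_time lam z t 1
  have ht : HasDerivAt (fun s : ℝ => lam ^ 2 * s / 2) (lam ^ 2 / 2) t := by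
    simpa using ((hasDerivAt_id t).const_mul (lam ^ 2)).div_const 2
  have := (hasDerivAt_exp_neg_mul_half lam t).mul ((h0.const_mul lam).add (ht.mul h1))
  refine this.congr_deriv ?_
  simp only [telegraphDensityT, telegraphDensity, Pi.add_apply, Pi.mul_apply]
  ring

theorem hasDerivAt_telegraphDensityT :
    HasDerivAt (fun s => telegraphDensityT lam z s) (telegraphDensityTT lam z t) t := by
  have h := hasDerivAt_telegraphDensity_time lam z t
  have h1 := hasDerivAt_besselSeries_time lam z t 1
  have h2 := hasDerivAt_besselSeries_time lam z t 2
  have ht : HasDerivAt (fun s : ℝ => lam ^ 2 * s / 2) (lam ^ 2 / 2) t := by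
    simpa using ((hasDerivAt_id t).const_mul (lam ^ 2)).div_const 2
  have := (h.const_mul (-lam)).add ((hasDerivAt_exp_neg_mul_half lam t).mul
    (((ht.mul h1).const_mul lam).add ((h1.const_mul (lam ^ 2 / 2)).add (ht.mul (ht.mul h2)))))
  refine this.congr_deriv ?_
  simp only [telegraphDensityTT, telegraphDensityT, telegraphDensity, Pi.add_apply, Pi.mul_apply]
  ring

theorem hasDerivAt_telegraphDensity_space :
    HasDerivAt (fun y => telegraphDensity lam y t) (telegraphDensityZ lam z t) z := by
  have h0 := hasDerivAt_besselSeries_space lam z t 0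
  have h1 := hasDerivAt_besselSeries_space lam z t 1
  exact ((h0.const_mul lam).add (h1.const_mul (lam ^ 2 * t / 2))).const_mul
    (Real.exp (-lam * t) / 2)

theorem hasDerivAt_telegraphDensityZ :
    HasDerivAt (fun y => telegraphDensityZ lam y t) (telegraphDensityZZ lam z t) z := by
  have h1 := hasDerivAt_besselSeries_space lam z t 1
  have h2 := hasDerivAt_besselSeries_space lam z t 2
  have hz : HasDerivAt (fun y : ℝ => -(lam ^ 2 * y / 2)) (-(lam ^ 2 / 2)) z := by
    simpa using (((hasDerivAt_id z).const_mul (lam ^ 2)).div_const 2).fun_neg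
  exact (((hz.mul h1).const_mul lam).add ((hz.mul h2).const_mul (lam ^ 2 * t / 2))).const_mul
    (Real.exp (-lam * t) / 2)

theorem telegraph_equation :
    telegraphDensityTT lam z t + 2 * lam * telegraphDensityT lam z t =
      telegraphDensityZZ lam z t := by
  have r0 := besselSeries_recurrence 0 (lam ^ 2 * (t ^ 2 - z ^ 2) / 4)
  have r1 := besselSeries_recurrence 1 (lam ^ 2 * (t ^ 2 - z ^ 2) / 4)
  simp only [telegraphDensityTT, telegraphDensityT, telegraphDensityZZ, telegraphDensity]
  norm_num at r0 r1
  linear_combination (Real.exp (-lam * t) / 2) * (lam ^ 3 * r0 + lam ^ 4 * t / 2 * r1)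

end Derivatives

/-- A Poisson process all of whose paths are regular. -/
structure IsRegularPoissonProcess {Ω : Type*} [MeasurableSpace Ω] (P : Measure Ω)
    (N : ℝ≥0 → Ω → ℕ) (lam : ℝ≥0) : Prop extends IsPoissonProcess P N lam where
  zero : ∀ ω, N 0 ω = 0
  mono : ∀ ω, Monotone fun t => N t ω
  rightCont : ∀ ω t, ContinuousWithinAt (fun s => N s ω) (Ici t) t

theorem IsPoissonProcess.exists_regular {Ω : Type*} [MeasurableSpace Ω] {P : Measure Ω}
    {N : ℝ≥0 → Ω → ℕ} {lam : ℝ≥0} (hN : IsPoissonProcess P N lam) :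
    ∃ N' : ℝ≥0 → Ω → ℕ, IsRegularPoissonProcess P N' lam ∧ ∀ᵐ ω ∂P, ∀ t, N' t ω = N t ω := by
  classical
  obtain ⟨G, hG, hGm, hGp⟩ := Eventually.exists_measurable_mem
    (hN.start_zero.and (hN.monotone_paths.and hN.rightCont_paths))
  let N' : ℝ≥0 → Ω → ℕ := fun t => G.indicator (N t)
  have hin : ∀ ω ∈ G, ∀ t, N' t ω = N t ω := fun ω h t => indicator_of_mem h _
  have hout : ∀ ω ∉ G, ∀ t, N' t ω = 0 := fun ω h t => indicator_of_notMem h _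
  have hae : ∀ᵐ ω ∂P, ∀ t, N' t ω = N t ω := by
    filter_upwards [hG] with ω h using hin ω h
  have hz : ∀ ω, N' 0 ω = 0 := fun ω => by
    by_cases h : ω ∈ G
    · rw [hin ω h, (hGp ω h).1]
    · exact hout ω h 0
  have hm : ∀ ω, Monotone fun t => N' t ω := fun ω => by
    by_cases h : ω ∈ G
    · simpa only [hin ω h] using (hGp ω h).2.1
    · simpa only [hout ω h] using monotone_const
  have hr : ∀ ω t, ContinuousWithinAt (fun s => N' s ω) (Ici t) t := fun ω t => by
    by_cases h : ω ∈ G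
    · simpa only [hin ω h] using (hGp ω h).2.2 t
    · simpa only [hout ω h] using continuousWithinAt_const
  refine ⟨N', ⟨⟨fun t => (hN.measurable t).indicator hGm, .of_forall hz, .of_forall hm,
    .of_forall hr, ?_, ?_⟩, hz, hm, hr⟩, hae⟩
  · intro n t ht
    refine (hN.indep_increments n t ht).congr fun i => ?_
    filter_upwards [hae] with ω h using by simp only [h]
  · intro s t hst
    rw [← hN.increments_law s t hst]
    refine Measure.map_congr ?_
    filter_upwards [hae] with ω h using by simp only [h]

/-- The `k`-th point of the grid of mesh `s / 2 ^ n` on `[0, s]`. -/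
noncomputable def dyadicTime (s : ℝ≥0) (n k : ℕ) : ℝ≥0 := s * (min k (2 ^ n) : ℕ) / 2 ^ n

/-- The σ-algebra generated by the values of a process at the dyadic grid points of `[0, s]`. -/
@[reducible] noncomputable def dyadicPast {Ω : Type*} (N : ℝ≥0 → Ω → ℕ) (s : ℝ≥0) : MeasurableSpace Ω :=
  ⨆ n, ⨆ k, MeasurableSpace.comap (N (dyadicTime s n k)) ⊤

theorem dyadicTime_succ (s : ℝ≥0) (n k : ℕ) :
    dyadicTime s (n + 1) (2 * k) = dyadicTime s n k := by
  have : min (2 * k) (2 ^ (n + 1)) = 2 * min k (2 ^ n) := by rw [pow_succ]; omega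
  rw [dyadicTime, dyadicTime, this, pow_succ]
  push_cast
  field_simp

theorem dyadicTime_mono (s : ℝ≥0) (n : ℕ) : Monotone (dyadicTime s n) := by
  intro i j hij
  unfold dyadicTime
  gcongr

theorem dyadicTime_le (s : ℝ≥0) (n k : ℕ) : dyadicTime s n k ≤ s := by
  unfold dyadicTime
  rw [div_le_iff₀ (by positivity)]
  gcongr
  exact_mod_cast min_le_right _ _

theorem dyadicTime_last (s : ℝ≥0) (n : ℕ) : dyadicTime s n (2 ^ n) = s := by
  simp [dyadicTime]

theorem dyadicTime_zero (s : ℝ≥0) (n : ℕ) : dyadicTime s n 0 = 0 := by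
  simp [dyadicTime]

theorem dyadicTime_min (s : ℝ≥0) (n k : ℕ) : dyadicTime s n (min k (2 ^ n)) = dyadicTime s n k := by
  simp [dyadicTime]

theorem measurable_dyadicPast {Ω : Type*} (N : ℝ≥0 → Ω → ℕ) (s : ℝ≥0) (n k : ℕ) :
    Measurable[dyadicPast N s] (N (dyadicTime s n k)) :=
  measurable_iff_comap_le.2 <|
    le_iSup₂_of_le (f := fun n k => MeasurableSpace.comap (N (dyadicTime s n k)) ⊤) n k le_rfl

section Independence
variable {Ω : Type*} [MeasurableSpace Ω] {P : Measure Ω} [IsProbabilityMeasure P]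
  {N : ℝ≥0 → Ω → ℕ} {lam : ℝ≥0}

theorem dyadicPast_le (hN : ∀ t, Measurable (N t)) (s : ℝ≥0) :
    dyadicPast N s ≤ (inferInstance : MeasurableSpace Ω) :=
  iSup₂_le fun _ _ => measurable_iff_comap_le.1 (hN _)

theorem IsRegularPoissonProcess.indep_dyadicPast (hN : IsRegularPoissonProcess P N lam)
    {s t : ℝ≥0} (hst : s ≤ t) :
    Indep (dyadicPast N s) (MeasurableSpace.comap (fun ω => N t ω - N s ω) ⊤) P := by
  refine indep_iSup_of_monotone (fun n => ?_)
    (fun n => iSup_le fun k => measurable_iff_comap_le.1 (hN.measurable _))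
    (measurable_iff_comap_le.1 ((hN.measurable t).sub (hN.measurable s)))
    (monotone_nat_of_le_succ fun n => iSup_le fun k => ?_)
  · let τ : ℕ → ℝ≥0 := fun i => if i ≤ 2 ^ n then dyadicTime s n i else t
    have hτ : Monotone τ := by
      intro i j hij
      simp only [τ]
      split_ifs with h1 h2
      · exact dyadicTime_mono s n hij
      · exact (dyadicTime_le s n i).trans hst
      · omega
      · exact le_rfl
    have hind := (hN.indep_increments.nat hτ).indepFun_finset (Finset.range (2 ^ n)) {2 ^ n}
      (by simp) (fun i => (hN.measurable _).sub (hN.measurable _))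
    rw [IndepFun_iff_Indep] at hind
    refine indep_of_indep_of_le_left (indep_of_indep_of_le_right hind ?_) ?_
    · rw [← measurable_iff_comap_le]
      have h := (measurable_pi_apply (X := fun _ : ({2 ^ n} : Finset ℕ) => ℕ)
        ⟨2 ^ n, Finset.mem_singleton_self _⟩).comp
        (comap_measurable (fun ω (i : ({2 ^ n} : Finset ℕ)) => N (τ (i + 1)) ω - N (τ i) ω))
      have e : (fun ω => N t ω - N s ω) = fun ω => N (τ (2 ^ n + 1)) ω - N (τ (2 ^ n)) ω := by
        simp [τ, dyadicTime_last]
      rw [e]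
      exact h
    · refine iSup_le fun k => ?_
      rw [← measurable_iff_comap_le]
      have e : N (dyadicTime s n k) = fun ω => ∑ i ∈ Finset.range (min k (2 ^ n)),
          (N (τ (i + 1)) ω - N (τ i) ω) := by
        ext ω
        rw [Finset.sum_range_tsub (f := fun i => N (τ i) ω) ((hN.mono ω).comp hτ)]
        simp [τ, dyadicTime_min, dyadicTime_zero, hN.zero]
      rw [e]
      refine Finset.measurable_sum _ fun i hi => ?_
      have hi' : i ∈ Finset.range (2 ^ n) := by
        rw [Finset.mem_range] at hi ⊢
        exact hi.trans_le (min_le_right _ _)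
      exact (measurable_pi_apply (X := fun _ : Finset.range (2 ^ n) => ℕ) ⟨i, hi'⟩).comp
        (comap_measurable (fun ω (i : Finset.range (2 ^ n)) => N (τ (i + 1)) ω - N (τ i) ω))
  · rw [← dyadicTime_succ]
    exact le_iSup (fun k => MeasurableSpace.comap (N (dyadicTime s (n + 1) k)) ⊤) (2 * k)

end Independence

/-- A right-continuous process stopped at `s` is jointly measurable with respect to its values on
the dyadic grid of `[0, s]`. -/
theorem measurable_stopped_of_rightCont {Ω : Type*} [MeasurableSpace Ω] {N : ℝ≥0 → Ω → ℕ}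
    {s : ℝ≥0} (hN : ∀ n k, Measurable (N (dyadicTime s n k)))
    (hr : ∀ ω t, ContinuousWithinAt (fun s => N s ω) (Ici t) t) :
    Measurable fun p : ℝ≥0 × Ω => N (min p.1 s) p.2 := by
  obtain ⟨κ, hκ⟩ : ∃ κ : ℕ → ℝ≥0 → ℕ, ∀ n, κ n = fun u => ⌈2 ^ n * (min u s / s)⌉₊ :=
    ⟨_, fun _ => rfl⟩
  refine measurable_of_tendsto_metrizable
    (f := fun n p => N (dyadicTime s n (κ n p.1)) p.2) (fun n => ?_)
    (tendsto_pi_nhds.2 fun p => ?_)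
  · have h1 : Measurable fun q : ℕ × Ω => N (dyadicTime s n q.1) q.2 :=
      measurable_from_prod_countable_right fun k => hN n k
    have h2 : Measurable (κ n) := by
      rw [hκ]
      exact Nat.measurable_ceil.comp (by fun_prop)
    have h3 : Measurable fun p : ℝ≥0 × Ω => (κ n p.1, p.2) :=
      (h2.comp measurable_fst).prodMk measurable_snd
    have h4 := h1.comp h3
    simp only [Function.comp_def] at h4
    exact h4
  · obtain ⟨u, ω⟩ := p
    change Tendsto (fun n => N (dyadicTime s n (κ n u)) ω) atTop (𝓝 (N (min u s) ω))
    refine (hr ω (min u s)).tendsto.comp (tendsto_nhdsWithin_iff.2 ⟨?_, .of_forall fun n => ?_⟩)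
    all_goals
      have hk : ∀ n, κ n u ≤ 2 ^ n := fun n => by
        rw [hκ]
        refine Nat.ceil_le.2 ?_
        push_cast
        exact mul_le_of_le_one_right (by positivity) (div_le_one_of_le₀ (min_le_right _ _) (by positivity))
      have hd : ∀ n, dyadicTime s n (κ n u) = s * κ n u / 2 ^ n := fun n => by
        rw [dyadicTime, min_eq_left (hk n)]
      have hlow : ∀ n, min u s ≤ dyadicTime s n (κ n u) := fun n => by
        rw [hd, le_div_iff₀ (by positivity)]
        rcases eq_or_ne s 0 with rfl | hs
        · simp
        calc min u s * 2 ^ n = s * (2 ^ n * (min u s / s)) := by field_simp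
          _ ≤ _ := by gcongr; rw [hκ]; exact Nat.le_ceil _
    · have hup : ∀ n, dyadicTime s n (κ n u) ≤ min u s + s / 2 ^ n := fun n => by
        rw [hd, div_le_iff₀ (by positivity)]
        rcases eq_or_ne s 0 with rfl | hs
        · simp
        calc s * κ n u ≤ s * (2 ^ n * (min u s / s) + 1) := by
              gcongr; rw [hκ]; exact (Nat.ceil_lt_add_one (by positivity)).le
          _ = _ := by field_simp
      refine tendsto_of_tendsto_of_tendsto_of_le_of_le tendsto_const_nhds ?_ hlow hup
      have : Tendsto (fun n : ℕ => s / 2 ^ n) atTop (𝓝 0) := by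
        have h : Tendsto (fun n : ℕ => (2⁻¹ : ℝ≥0) ^ n) atTop (𝓝 0) :=
          NNReal.tendsto_pow_atTop_nhds_zero_of_lt_one (by
            rw [← NNReal.coe_lt_coe]; norm_num)
        simpa [div_eq_mul_inv] using h.const_mul s
      simpa using this.const_add (min u s)
    · exact hlow n

theorem measurable_uncurry_of_rightCont {Ω : Type*} [MeasurableSpace Ω] {N : ℝ≥0 → Ω → ℕ}
    (hN : ∀ t, Measurable (N t))
    (hr : ∀ ω t, ContinuousWithinAt (fun s => N s ω) (Ici t) t) :
    Measurable fun p : ℝ≥0 × Ω => N p.1 p.2 := by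
  refine measurable_of_tendsto_metrizable (f := fun (n : ℕ) p => N (min p.1 n) p.2)
    (fun n => measurable_stopped_of_rightCont (fun _ _ => hN _) hr) (tendsto_pi_nhds.2 fun p => ?_)
  obtain ⟨m, hm⟩ := exists_nat_ge p.1
  refine tendsto_const_nhds.congr' ?_
  filter_upwards [eventually_ge_atTop m] with n hn
  rw [min_eq_left (hm.trans (by exact_mod_cast hn))]

/-- The indicator of the even numbers. -/
noncomputable def evenInd (k : ℕ) : ℝ := if Even k then 1 else 0

theorem evenInd_nonneg (k : ℕ) : 0 ≤ evenInd k := by unfold evenInd; split_ifs <;> norm_num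

theorem evenInd_le_one (k : ℕ) : evenInd k ≤ 1 := by unfold evenInd; split_ifs <;> norm_num

theorem norm_evenInd_le_one (k : ℕ) : ‖evenInd k‖ ≤ 1 := by
  rw [Real.norm_of_nonneg (evenInd_nonneg k)]
  exact evenInd_le_one k

/-- The time during `[0, t]` at which `N` is even. -/
noncomputable def evenTime {Ω : Type*} (N : ℝ≥0 → Ω → ℕ) (t : ℝ) (ω : Ω) : ℝ :=
  ∫ u in (0 : ℝ)..t, evenInd (N u.toNNReal ω)

section Paths
variable {Ω : Type*} {N : ℝ≥0 → Ω → ℕ} {ω : Ω}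

theorem monotone_path_toNNReal (hm : Monotone fun t => N t ω) :
    Monotone fun u : ℝ => N u.toNNReal ω := fun _ _ h => hm (Real.toNNReal_le_toNNReal h)

theorem measurable_evenInd_path (hm : Monotone fun t => N t ω) :
    Measurable fun u : ℝ => evenInd (N u.toNNReal ω) :=
  (measurable_of_countable evenInd).comp (monotone_path_toNNReal hm).measurable

theorem intervalIntegrable_evenInd_path (hm : Monotone fun t => N t ω) (a b : ℝ) :
    IntervalIntegrable (fun u : ℝ => evenInd (N u.toNNReal ω)) volume a b :=
  intervalIntegrable_const.mono_fun (measurable_evenInd_path hm).aestronglyMeasurable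
    (.of_forall fun u => by simpa using norm_evenInd_le_one _ : _ ≤ᵐ[_] fun _ => ‖(1 : ℝ)‖)

theorem continuous_evenTime (hm : Monotone fun t => N t ω) :
    Continuous fun t : ℝ => evenTime N t ω :=
  intervalIntegral.continuous_primitive (intervalIntegrable_evenInd_path hm) 0

theorem evenTime_nonneg {t : ℝ} (ht : 0 ≤ t) : 0 ≤ evenTime N t ω :=
  intervalIntegral.integral_nonneg ht fun _ _ => evenInd_nonneg _

theorem evenTime_le (hm : Monotone fun t => N t ω) {t : ℝ} (ht : 0 ≤ t) : evenTime N t ω ≤ t := by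
  have := intervalIntegral.integral_mono_on ht (intervalIntegrable_evenInd_path hm 0 t)
    (intervalIntegrable_const (c := (1 : ℝ))) fun u _ => evenInd_le_one _
  simpa [evenTime] using this

theorem evenTime_pow_le (hm : Monotone fun t => N t ω) {s t : ℝ} (hs : 0 ≤ s) (hst : s ≤ t)
    (m : ℕ) : ‖evenTime N s ω ^ m‖ ≤ t ^ m := by
  rw [norm_pow, Real.norm_of_nonneg (evenTime_nonneg hs)]
  exact pow_le_pow_left₀ (evenTime_nonneg hs) ((evenTime_le hm hs).trans hst) m

theorem hasDerivAt_evenTime (hm : Monotone fun t => N t ω) {u : ℝ}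
    (hu : ContinuousAt (fun u : ℝ => N u.toNNReal ω) u) :
    HasDerivAt (fun t => evenTime N t ω) (evenInd (N u.toNNReal ω)) u :=
  intervalIntegral.integral_hasDerivAt_right (intervalIntegrable_evenInd_path hm 0 u)
    ((measurable_evenInd_path hm).stronglyMeasurable.stronglyMeasurableAtFilter)
    ((continuous_of_discreteTopology (f := evenInd)).continuousAt.comp hu)

theorem evenTime_pow_succ (hm : Monotone fun t => N t ω) {t : ℝ} (ht : 0 ≤ t) (m : ℕ) :
    evenTime N t ω ^ (m + 1) =
      ∫ u in (0 : ℝ)..t, (m + 1) * (evenTime N u ω ^ m * evenInd (N u.toNNReal ω)) := by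
  have h := integral_eq_of_hasDerivAt_off_countable_of_le (fun u => evenTime N u ω ^ (m + 1))
    (fun u => (m + 1) * (evenTime N u ω ^ m * evenInd (N u.toNNReal ω))) ht
    (monotone_path_toNNReal hm).countable_not_continuousAt
    ((continuous_evenTime hm).pow (m + 1)).continuousOn
    (fun u hu => ?_) ?_
  · rw [h]
    simp [evenTime]
  · have := (hasDerivAt_evenTime hm (not_not.1 hu.2)).fun_pow (m + 1)
    refine this.congr_deriv ?_
    rw [Nat.add_sub_cancel]
    push_cast
    ring
  · exact ((intervalIntegrable_evenInd_path hm 0 t).continuousOn_mul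
      ((continuous_evenTime hm).pow m).continuousOn).const_mul _

end Paths

section Measurability
variable {Ω : Type*} [MeasurableSpace Ω] {N : ℝ≥0 → Ω → ℕ}

theorem measurable_evenTime_of_dyadic {s : ℝ≥0} (hN : ∀ n k, Measurable (N (dyadicTime s n k)))
    (hr : ∀ ω t, ContinuousWithinAt (fun s => N s ω) (Ici t) t) :
    Measurable fun ω => evenTime N s ω := by
  have h : Measurable fun p : Ω × ℝ => evenInd (N (min p.2.toNNReal s) p.1) := by
    have h1 := measurable_stopped_of_rightCont hN hr
    have h2 : Measurable fun p : Ω × ℝ => (p.2.toNNReal, p.1) := by fun_prop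
    have h3 := (measurable_of_countable evenInd).comp (h1.comp h2)
    simpa only [Function.comp_def] using h3
  have e : (fun ω => evenTime N s ω) =
      fun ω => ∫ u in Ioc (0 : ℝ) s, evenInd (N (min u.toNNReal s) ω) := by
    ext ω
    rw [evenTime, intervalIntegral.integral_of_le s.coe_nonneg]
    refine setIntegral_congr_fun measurableSet_Ioc fun u hu => ?_
    have : u.toNNReal ≤ s := Real.toNNReal_le_iff_le_coe.2 hu.2
    simp only [min_eq_left this]
  rw [e]
  exact (StronglyMeasurable.integral_prod_right (f := fun ω (u : ℝ) => evenInd (N (min u.toNNReal s) ω))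
    h.stronglyMeasurable).measurable

theorem measurable_evenTime (hN : ∀ t, Measurable (N t))
    (hr : ∀ ω t, ContinuousWithinAt (fun s => N s ω) (Ici t) t) (s : ℝ≥0) :
    Measurable fun ω => evenTime N s ω :=
  measurable_evenTime_of_dyadic (fun _ _ => hN _) hr

theorem measurable_uncurry_evenInd (hN : ∀ t, Measurable (N t))
    (hr : ∀ ω t, ContinuousWithinAt (fun s => N s ω) (Ici t) t) :
    Measurable fun p : ℝ × Ω => evenInd (N p.1.toNNReal p.2) := by
  have h1 := measurable_uncurry_of_rightCont hN hr
  have h2 : Measurable fun p : ℝ × Ω => (p.1.toNNReal, p.2) := by fun_prop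
  have h3 := (measurable_of_countable evenInd).comp (h1.comp h2)
  simpa only [Function.comp_def] using h3

theorem measurable_uncurry_evenTime (hN : ∀ t, Measurable (N t))
    (hm : ∀ ω, Monotone fun t => N t ω)
    (hr : ∀ ω t, ContinuousWithinAt (fun s => N s ω) (Ici t) t) :
    Measurable fun p : ℝ × Ω => evenTime N (p.1.toNNReal : ℝ) p.2 := by
  have := measurable_uncurry_of_continuous_of_measurable
    (u := fun (t : ℝ≥0) ω => evenTime N t ω)
    (fun ω => (continuous_evenTime (hm ω)).comp NNReal.continuous_coe)
    (fun s => measurable_evenTime hN hr s)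
  have h2 : Measurable fun p : ℝ × Ω => (p.1.toNNReal, p.2) := by fun_prop
  exact this.comp h2

end Measurability

section Moments
variable {Ω : Type*} [MeasurableSpace Ω] {P : Measure Ω} [IsProbabilityMeasure P]
  {N : ℝ≥0 → Ω → ℕ} {lam : ℝ≥0}

omit [IsProbabilityMeasure P] in
theorem IsPoissonProcess.real_increment (hN : IsPoissonProcess P N lam) {s t : ℝ≥0} (hst : s ≤ t)
    (j : ℕ) : ∫ ω, (if N t ω - N s ω = j then (1 : ℝ) else 0) ∂P =
      Real.exp (-(lam * (t - s))) * (lam * (t - s)) ^ j / j ! := by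
  have hm : Measurable fun ω => N t ω - N s ω := (hN.measurable t).sub (hN.measurable s)
  have h := poissonMeasure_real_singleton (lam * (t - s)) j
  rw [← hN.increments_law s t hst, map_measureReal_apply hm (measurableSet_singleton j)] at h
  have e : (fun ω => if N t ω - N s ω = j then (1 : ℝ) else 0) =
      ((fun ω => N t ω - N s ω) ⁻¹' {j}).indicator 1 := by
    ext ω
    by_cases h : N t ω - N s ω = j
    · rw [if_pos h, indicator_of_mem (by exact h), Pi.one_apply]
    · rw [if_neg h, indicator_of_notMem (by exact h)]
  rw [e, integral_indicator_one (hm (measurableSet_singleton j)), h]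
  simp [NNReal.coe_sub hst]

theorem measurable_ite_eq (hN : ∀ t, Measurable (N t)) (t : ℝ≥0) (n : ℕ) :
    Measurable fun ω => if N t ω = n then (1 : ℝ) else 0 :=
  (measurable_of_countable fun k : ℕ => if k = n then (1 : ℝ) else 0).comp (hN t)

theorem norm_ite_le_one (p : Prop) [Decidable p] : ‖(if p then (1 : ℝ) else 0)‖ ≤ 1 := by
  split_ifs <;> simp

theorem IsRegularPoissonProcess.integral_split (hN : IsRegularPoissonProcess P N lam)
    {s t : ℝ≥0} (hst : s ≤ t) (m n : ℕ) :
    ∫ ω, evenTime N s ω ^ m * evenInd (N s ω) * (if N t ω = n then 1 else 0) ∂P =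
      ∑ k ∈ Finset.range (n / 2 + 1),
        (∫ ω, evenTime N s ω ^ m * (if N s ω = 2 * k then 1 else 0) ∂P) *
          (Real.exp (-(lam * (t - s))) * (lam * (t - s)) ^ (n - 2 * k) / (n - 2 * k)!) := by
  have hpt : ∀ ω, evenTime N s ω ^ m * evenInd (N s ω) * (if N t ω = n then 1 else 0) =
      ∑ k ∈ Finset.range (n / 2 + 1), (evenTime N s ω ^ m * (if N s ω = 2 * k then 1 else 0)) *
        (if N t ω - N s ω = n - 2 * k then 1 else 0) := by
    intro ω
    have hle : N s ω ≤ N t ω := hN.mono ω hst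
    by_cases h : Even (N s ω) ∧ N t ω = n
    · obtain ⟨⟨j, hj⟩, hn⟩ := h
      rw [Finset.sum_eq_single_of_mem j (Finset.mem_range.2 (by omega))
        fun k _ hk => by rw [if_neg (show N s ω ≠ 2 * k by omega)]; ring]
      rw [if_pos hn, if_pos (show N s ω = 2 * j by omega),
        if_pos (show N t ω - N s ω = n - 2 * j by omega), evenInd, if_pos ⟨j, hj⟩]
    · rw [Finset.sum_eq_zero]
      · rw [evenInd]
        rcases not_and_or.1 h with h | h
        · rw [if_neg h]; ring
        · rw [if_neg h]; ring
      · intro k hk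
        rw [Finset.mem_range] at hk
        by_cases h1 : N s ω = 2 * k
        · have h2 : N t ω ≠ n := fun h2 => h ⟨⟨k, by omega⟩, h2⟩
          rw [if_neg (show N t ω - N s ω ≠ n - 2 * k by omega), mul_zero]
        · rw [if_neg h1]; ring
  have hW : ∀ k, Measurable[dyadicPast N s]
      fun ω => evenTime N s ω ^ m * (if N s ω = 2 * k then (1 : ℝ) else 0) := by
    intro k
    have h1 : Measurable[dyadicPast N s] fun ω => evenTime N s ω :=
      @measurable_evenTime_of_dyadic Ω (dyadicPast N s) N s (measurable_dyadicPast N s) hN.rightCont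
    have h2 : Measurable[dyadicPast N s] (N s) := by
      have h := measurable_dyadicPast N s 0 (2 ^ 0)
      rwa [dyadicTime_last] at h
    have h3 : Measurable[dyadicPast N s] fun ω => if N s ω = 2 * k then (1 : ℝ) else 0 :=
      (measurable_of_countable fun j : ℕ => if j = 2 * k then (1 : ℝ) else 0).comp h2
    exact (h1.pow_const m).mul h3
  have hW' := fun k => (hW k).mono (dyadicPast_le hN.measurable s) le_rfl
  have hV : ∀ j : ℕ, Measurable fun ω => if N t ω - N s ω = j then (1 : ℝ) else 0 := fun j =>
    (measurable_of_countable fun i : ℕ => if i = j then (1 : ℝ) else 0).comp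
      ((hN.measurable t).sub (hN.measurable s))
  simp only [hpt]
  rw [integral_finsetSum]
  · refine Finset.sum_congr rfl fun k _ => ?_
    rw [← hN.real_increment hst]
    refine IndepFun.integral_fun_mul_eq_mul_integral ?_ (hW' k).aestronglyMeasurable
      (hV _).aestronglyMeasurable
    rw [IndepFun_iff_Indep]
    refine indep_of_indep_of_le_left (indep_of_indep_of_le_right (hN.indep_dyadicPast hst) ?_)
      (measurable_iff_comap_le.1 (hW k))
    rw [← measurable_iff_comap_le]
    exact (measurable_of_countable fun i : ℕ => if i = n - 2 * k then (1 : ℝ) else 0).comp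
      (comap_measurable fun ω => N t ω - N s ω)
  · intro k _
    refine Integrable.of_bound ((hW' k).mul (hV _)).aestronglyMeasurable ((s : ℝ) ^ m)
      (.of_forall fun ω => ?_)
    rw [norm_mul, norm_mul]
    calc _ ≤ (s : ℝ) ^ m * 1 * 1 := by
          gcongr
          · exact evenTime_pow_le (hN.mono ω) s.coe_nonneg le_rfl m
          · exact norm_ite_le_one _
          · exact norm_ite_le_one _
      _ = _ := by ring

/-- The moments of the time spent in even states, on the event that `n` jumps occurred. -/
theorem IsRegularPoissonProcess.integral_evenTime_pow (hN : IsRegularPoissonProcess P N lam)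
    (m n : ℕ) (t : ℝ≥0) :
    ∫ ω, evenTime N t ω ^ m * (if N t ω = n then 1 else 0) ∂P =
      Real.exp (-(lam * t)) * lam ^ n * ((m + n / 2)! / (n / 2)!) * (t ^ (m + n) / (m + n)!) := by
  induction m generalizing n t with
  | zero =>
    have h := hN.real_increment (zero_le : 0 ≤ t) n
    simp only [hN.zero, Nat.sub_zero, NNReal.coe_zero, sub_zero] at h
    simp only [pow_zero, one_mul, zero_add, h]
    rw [div_self (by positivity), mul_pow]
    ring
  | succ m ih =>
    have hF : Integrable (Function.uncurry fun (u : ℝ) ω => (m + 1 : ℝ) *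
        (evenTime N u ω ^ m * evenInd (N u.toNNReal ω) * (if N t ω = n then 1 else 0)))
        ((volume.restrict (uIoc (0 : ℝ) t)).prod P) := by
      have hmeas : Measurable (Function.uncurry fun (u : ℝ) ω => (m + 1 : ℝ) *
        (evenTime N (u.toNNReal : ℝ) ω ^ m * evenInd (N u.toNNReal ω) *
          (if N t ω = n then 1 else 0))) := by
        refine ((((measurable_uncurry_evenTime hN.measurable hN.mono hN.rightCont).pow_const m).mul
          (measurable_uncurry_evenInd hN.measurable hN.rightCont)).mul
          ((measurable_ite_eq hN.measurable t n).comp measurable_snd)).const_mul _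
      have hmem : ∀ᵐ p : ℝ × Ω ∂((volume.restrict (uIoc (0 : ℝ) t)).prod P), p.1 ∈ Ioc (0 : ℝ) t := by
        refine Measure.quasiMeasurePreserving_fst.ae (p := fun u => u ∈ Ioc (0 : ℝ) t) ?_
        rw [uIoc_of_le t.coe_nonneg]
        exact ae_restrict_mem measurableSet_Ioc
      have : IsFiniteMeasure (volume.restrict (uIoc (0 : ℝ) t)) := by
        rw [uIoc_of_le t.coe_nonneg]
        infer_instance
      refine Integrable.of_bound (C := (m + 1 : ℝ) * ((t : ℝ) ^ m * 1 * 1)) ?_ ?_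
      · refine hmeas.aestronglyMeasurable.congr ?_
        filter_upwards [hmem] with p hp
        simp only [Function.uncurry, Real.coe_toNNReal _ hp.1.le]
      · filter_upwards [hmem] with p hp
        simp only [Function.uncurry, norm_mul]
        gcongr
        · rw [Real.norm_of_nonneg (by positivity)]
        · exact evenTime_pow_le (hN.mono _) hp.1.le hp.2 m
        · exact norm_evenInd_le_one _
        · exact norm_ite_le_one _
    have h1 : ∀ ω, evenTime N t ω ^ (m + 1) * (if N t ω = n then (1 : ℝ) else 0) =
        ∫ u in (0 : ℝ)..t, (m + 1 : ℝ) *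
          (evenTime N u ω ^ m * evenInd (N u.toNNReal ω) * (if N t ω = n then 1 else 0)) := by
      intro ω
      rw [evenTime_pow_succ (hN.mono ω) t.coe_nonneg, ← intervalIntegral.integral_mul_const]
      simp only [mul_assoc]
    simp only [h1]
    rw [← intervalIntegral_integral_swap hF]
    have h2 : ∀ u ∈ uIcc (0 : ℝ) t, ∫ ω, (m + 1 : ℝ) *
        (evenTime N u ω ^ m * evenInd (N u.toNNReal ω) * (if N t ω = n then 1 else 0)) ∂P =
        ∑ k ∈ Finset.range (n / 2 + 1), (m + 1 : ℝ) * (Real.exp (-(lam * t)) * lam ^ n *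
          ((m + k)! / k !) / ((m + 2 * k)! * (n - 2 * k)!)) *
            (u ^ (m + 2 * k) * (t - u) ^ (n - 2 * k)) := by
      intro u hu
      rw [uIcc_of_le t.coe_nonneg] at hu
      lift u to ℝ≥0 using hu.1
      rw [integral_const_mul, Real.toNNReal_coe,
        hN.integral_split (by exact_mod_cast hu.2), Finset.mul_sum]
      refine Finset.sum_congr rfl fun k hk => ?_
      have hk' : 2 * k ≤ n := by rw [Finset.mem_range] at hk; omega
      have e1 : Real.exp (-(lam * t)) =
          Real.exp (-(lam * u)) * Real.exp (-(lam * (t - u)) : ℝ) := by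
        rw [← Real.exp_add]; congr 1; ring
      have e2 : (lam : ℝ) ^ n = lam ^ (2 * k) * lam ^ (n - 2 * k) := by
        rw [← pow_add]; congr 1; omega
      rw [ih, e1, e2, mul_pow, Nat.mul_div_cancel_left k two_pos]
      field_simp
    rw [intervalIntegral.integral_congr h2, intervalIntegral.integral_finsetSum
      fun k _ => by apply Continuous.intervalIntegrable; fun_prop]
    have h3 : ∀ k ∈ Finset.range (n / 2 + 1), ∫ u in (0 : ℝ)..t, (m + 1 : ℝ) *
        (Real.exp (-(lam * t)) * lam ^ n * ((m + k)! / k !) / ((m + 2 * k)! * (n - 2 * k)!)) *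
            (u ^ (m + 2 * k) * (t - u) ^ (n - 2 * k)) =
        (Real.exp (-(lam * t)) * lam ^ n * (t ^ (m + 1 + n) / (m + 1 + n)!)) *
          ((m + 1 : ℝ) * (((m + k)! : ℝ) / k !)) := by
      intro k hk
      have hk' : 2 * k ≤ n := by rw [Finset.mem_range] at hk; omega
      rw [intervalIntegral.integral_const_mul, integral_pow_mul_sub_pow,
        show m + 2 * k + (n - 2 * k) + 1 = m + 1 + n by omega]
      field_simp
    rw [Finset.sum_congr rfl h3, ← Finset.mul_sum, ← Finset.mul_sum, sum_ascending_factorial_div]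
    ring

end Moments

/-- The density of the time spent in even states during `[0, t]`, on the event of `n + 1` jumps. -/
noncomputable def evenTimeTerm (lam t : ℝ) (n : ℕ) (r : ℝ) : ℝ :=
  Real.exp (-(lam * t)) * lam ^ (n + 1) * (r ^ ((n + 1) / 2) / ((n + 1) / 2)!) *
    ((t - r) ^ (n - (n + 1) / 2) / (n - (n + 1) / 2)!)

/-- The density of the absolutely continuous part of the law of the time spent in even states. -/
noncomputable def evenTimeDensity (lam t r : ℝ) : ℝ :=
  Real.exp (-(lam * t)) * (lam * besselSeries 0 (lam ^ 2 * (r * (t - r))) +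
    lam ^ 2 * r * besselSeries 1 (lam ^ 2 * (r * (t - r))))

theorem hasSum_evenTimeTerm (lam t r : ℝ) :
    HasSum (fun n => evenTimeTerm lam t n r) (evenTimeDensity lam t r) := by
  rw [evenTimeDensity, mul_add]
  refine HasSum.even_add_odd ?_ ?_
  · refine (((hasSum_besselSeries 0 _).mul_left lam).mul_left _).congr_fun fun k => ?_
    rw [evenTimeTerm, show (2 * k + 1) / 2 = k by omega, show 2 * k - k = k by omega, add_zero,
      mul_pow, mul_pow, ← pow_mul]
    field_simp
    ring
  · refine (((hasSum_besselSeries 1 _).mul_left (lam ^ 2 * r)).mul_left _).congr_fun fun k => ?_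
    rw [evenTimeTerm, show (2 * k + 1 + 1) / 2 = k + 1 by omega,
      show 2 * k + 1 - (k + 1) = k by omega, mul_pow, mul_pow, ← pow_mul]
    field_simp
    ring

theorem continuous_evenTimeTerm (lam t : ℝ) (n : ℕ) : Continuous (evenTimeTerm lam t n) := by
  unfold evenTimeTerm
  fun_prop

theorem evenTimeTerm_nonneg {lam t r : ℝ} (hlam : 0 ≤ lam) (hr : r ∈ Icc 0 t) (n : ℕ) :
    0 ≤ evenTimeTerm lam t n r := by
  have := hr.1
  have := sub_nonneg.2 hr.2
  unfold evenTimeTerm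
  positivity

section Law
variable {Ω : Type*} [MeasurableSpace Ω] {P : Measure Ω} [IsProbabilityMeasure P]
  {N : ℝ≥0 → Ω → ℕ} {lam : ℝ≥0}

theorem IsRegularPoissonProcess.moment_map_restrict (hN : IsRegularPoissonProcess P N lam)
    (t : ℝ≥0) (n m : ℕ) :
    ∫ x, x ^ m ∂((P.restrict {ω | N t ω = n}).map fun ω => evenTime N t ω) =
      Real.exp (-(lam * t)) * lam ^ n * ((m + n / 2)! / (n / 2)!) * (t ^ (m + n) / (m + n)!) := by
  have hS : MeasurableSet {ω | N t ω = n} := hN.measurable t (measurableSet_singleton n)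
  rw [integral_map (measurable_evenTime hN.measurable hN.rightCont t).aemeasurable (by fun_prop),
    ← integral_indicator hS, ← hN.integral_evenTime_pow]
  refine integral_congr_ae (.of_forall fun ω => ?_)
  by_cases h : N t ω = n
  · simp only [indicator_of_mem (show ω ∈ {ω | N t ω = n} from h), if_pos h, mul_one]
  · simp only [indicator_of_notMem (show ω ∉ {ω | N t ω = n} from h), if_neg h, mul_zero]

omit [IsProbabilityMeasure P] in
theorem IsRegularPoissonProcess.map_restrict_compl (hN : IsRegularPoissonProcess P N lam)
    (t : ℝ≥0) (S : Set Ω) :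
    ((P.restrict S).map fun ω => evenTime N t ω) (Icc (0 : ℝ) t)ᶜ = 0 := by
  rw [Measure.map_apply (measurable_evenTime hN.measurable hN.rightCont t)
    measurableSet_Icc.compl]
  convert measure_empty (μ := P.restrict S)
  refine eq_empty_of_forall_notMem fun ω hω => hω ⟨evenTime_nonneg t.coe_nonneg,
    evenTime_le (hN.mono ω) t.coe_nonneg⟩

theorem IsRegularPoissonProcess.map_evenTime_zero_jumps (hN : IsRegularPoissonProcess P N lam)
    (t : ℝ≥0) : ((P.restrict {ω | N t ω = 0}).map fun ω => evenTime N t ω) =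
      ENNReal.ofReal (Real.exp (-(lam * t))) • Measure.dirac (t : ℝ) := by
  have : IsFiniteMeasure (ENNReal.ofReal (Real.exp (-(lam * t))) • Measure.dirac (t : ℝ)) :=
    Measure.smul_finite _ ENNReal.ofReal_ne_top
  refine measure_eq_of_moments_eq (hN.map_restrict_compl t _) ?_ fun m => ?_
  · have : (t : ℝ) ∈ Icc (0 : ℝ) t := ⟨t.coe_nonneg, le_rfl⟩
    simp [Measure.dirac_apply' _ measurableSet_Icc.compl, this]
  · rw [hN.moment_map_restrict, integral_smul_measure, integral_dirac,
      ENNReal.toReal_ofReal (by positivity), smul_eq_mul]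
    simp only [pow_zero, Nat.zero_div, add_zero, Nat.factorial_zero, Nat.cast_one]
    field_simp

theorem IsRegularPoissonProcess.map_evenTime_succ_jumps (hN : IsRegularPoissonProcess P N lam)
    (t : ℝ≥0) (n : ℕ) : ((P.restrict {ω | N t ω = n + 1}).map fun ω => evenTime N t ω) =
      (volume.restrict (Icc (0 : ℝ) t)).withDensity
        fun r => ENNReal.ofReal (evenTimeTerm lam t n r) := by
  have hint : ∀ g : ℝ → ℝ, Continuous g → IntegrableOn g (Icc (0 : ℝ) t) := fun g hg =>
    hg.continuousOn.integrableOn_compact isCompact_Icc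
  have : IsFiniteMeasure ((volume.restrict (Icc (0 : ℝ) t)).withDensity
        fun r => ENNReal.ofReal (evenTimeTerm lam t n r)) :=
    isFiniteMeasure_withDensity_ofReal (hint _ (continuous_evenTimeTerm _ _ _)).2
  refine measure_eq_of_moments_eq (hN.map_restrict_compl t _) ?_ fun m => ?_
  · exact withDensity_absolutelyContinuous _ _ (by
      rw [Measure.restrict_apply measurableSet_Icc.compl, compl_inter_self, measure_empty])
  · rw [hN.moment_map_restrict, integral_withDensity_eq_integral_toReal_smul
      (continuous_evenTimeTerm _ _ _).measurable.ennreal_ofReal (.of_forall fun _ => by simp)]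
    have h1 : ∀ r ∈ Icc (0 : ℝ) t, (ENNReal.ofReal (evenTimeTerm lam t n r)).toReal • r ^ m =
        (Real.exp (-(lam * t)) * lam ^ (n + 1) / (((n + 1) / 2)! * (n - (n + 1) / 2)!)) *
          (r ^ (m + (n + 1) / 2) * (t - r) ^ (n - (n + 1) / 2)) := by
      intro r hr
      rw [ENNReal.toReal_ofReal (evenTimeTerm_nonneg lam.coe_nonneg hr n), smul_eq_mul,
        evenTimeTerm, pow_add]
      ring
    rw [setIntegral_congr_fun measurableSet_Icc h1, integral_Icc_eq_integral_Ioc,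
      ← intervalIntegral.integral_of_le t.coe_nonneg, intervalIntegral.integral_const_mul,
      integral_pow_mul_sub_pow, show m + (n + 1) / 2 + (n - (n + 1) / 2) + 1 = m + (n + 1) by omega]
    field_simp

theorem IsRegularPoissonProcess.map_evenTime (hN : IsRegularPoissonProcess P N lam) (t : ℝ≥0) :
    P.map (fun ω => evenTime N t ω) =
      ENNReal.ofReal (Real.exp (-(lam * t))) • Measure.dirac (t : ℝ) +
      (volume.restrict (Icc (0 : ℝ) t)).withDensity
        fun r => ENNReal.ofReal (evenTimeDensity lam t r) := by
  have hR := measurable_evenTime hN.measurable hN.rightCont t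
  have hS : ∀ n, MeasurableSet {ω | N t ω = n} := fun n =>
    hN.measurable t (measurableSet_singleton n)
  ext A hA
  have h1 : P.map (fun ω => evenTime N t ω) A =
      ∑' n, ((P.restrict {ω | N t ω = n}).map fun ω => evenTime N t ω) A := by
    simp only [Measure.map_apply hR hA, Measure.restrict_apply (hR hA)]
    rw [← measure_iUnion]
    · congr 1
      ext ω
      simp
    · intro i j hij
      refine Set.disjoint_left.2 fun ω h1 h2 => hij ?_
      exact h1.2.symm.trans h2.2
    · exact fun n => (hR hA).inter (hS n)
  rw [h1, tsum_eq_zero_add' ENNReal.summable, hN.map_evenTime_zero_jumps, Measure.add_apply]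
  congr 1
  simp only [hN.map_evenTime_succ_jumps, withDensity_apply _ hA]
  rw [← lintegral_tsum fun n =>
    (continuous_evenTimeTerm _ _ _).measurable.ennreal_ofReal.aemeasurable]
  refine lintegral_congr_ae ?_
  have : ∀ᵐ r ∂((volume.restrict (Icc (0 : ℝ) t)).restrict A), r ∈ Icc (0 : ℝ) t :=
    ae_restrict_of_ae (ae_restrict_mem measurableSet_Icc)
  filter_upwards [this] with r hr
  rw [← (hasSum_evenTimeTerm lam t r).tsum_eq, ENNReal.ofReal_tsum_of_nonneg
    (evenTimeTerm_nonneg lam.coe_nonneg hr) (hasSum_evenTimeTerm lam t r).summable]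

end Law

section Telegraph
variable {Ω : Type*} [MeasurableSpace Ω] {P : Measure Ω} [IsProbabilityMeasure P]
  {N N' : ℝ≥0 → Ω → ℕ} {lam : ℝ≥0} {T : ℝ≥0∞} {D₀ : Ω → ℝ} {Z : ℝ≥0 → Ω → ℝ}

theorem neg_one_pow_eq_evenInd (n : ℕ) : (-1 : ℝ) ^ n = 2 * evenInd n - 1 := by
  unfold evenInd
  split_ifs with h
  · rw [h.neg_one_pow]; norm_num
  · rw [(Nat.not_even_iff_odd.1 h).neg_one_pow]; norm_num

omit [IsProbabilityMeasure P] in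
/-- A telegraph process is a function of its initial direction and the time spent in even states. -/
theorem IsTelegraphProcess.ae_eq_evenTime (hZ : IsTelegraphProcess P 1 lam T D₀ N Z)
    (hN' : IsRegularPoissonProcess P N' lam) (hNN' : ∀ᵐ ω ∂P, ∀ t, N' t ω = N t ω)
    {t : ℝ≥0} (ht : (t : ℝ≥0∞) < T) :
    ∀ᵐ ω ∂P, Z t ω = D₀ ω * (2 * evenTime N' t ω - t) := by
  filter_upwards [hNN', hZ.start, hZ.continuous_paths, hZ.velocity] with ω hN h0 hc hv
  have hm := hN'.mono ω
  have hI := intervalIntegrable_evenInd_path hm 0 t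
  have h := integral_eq_of_hasDerivAt_off_countable_of_le (fun u : ℝ => Z u.toNNReal ω)
    (fun u => D₀ ω * (2 * evenInd (N' u.toNNReal ω) - 1)) t.coe_nonneg
    (monotone_path_toNNReal hm).countable_not_continuousAt ?_ (fun u hu => ?_) ?_
  · rw [intervalIntegral.integral_const_mul, intervalIntegral.integral_sub (hI.const_mul 2)
      intervalIntegrable_const, intervalIntegral.integral_const_mul] at h
    simp only [intervalIntegral.integral_const, Real.toNNReal_coe, Real.toNNReal_zero, h0,
      smul_eq_mul, mul_one, sub_zero] at h
    exact h.symm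
  · refine hc.comp continuous_real_toNNReal.continuousOn fun u hu => ?_
    have : u.toNNReal ≤ t := Real.toNNReal_le_iff_le_coe.2 hu.2
    exact lt_of_le_of_lt (by exact_mod_cast this) ht
  · have hu0 : 0 < u := hu.1.1
    have hut : u.toNNReal ≤ t := Real.toNNReal_le_iff_le_coe.2 hu.1.2.le
    have hcont : ContinuousAt (fun s => N s ω) u.toNNReal := by
      have h1 : ContinuousAt (fun u : ℝ => N' u.toNNReal ω) u := not_not.1 hu.2
      rw [← Real.coe_toNNReal u hu0.le] at h1
      have h2 := ContinuousAt.comp (f := fun s : ℝ≥0 => (s : ℝ)) h1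
        NNReal.continuous_coe.continuousAt
      simpa only [Function.comp_def, Real.toNNReal_coe, hN] using h2
    have h3 := hv u.toNNReal (Real.toNNReal_pos.2 hu0)
      (lt_of_le_of_lt (by exact_mod_cast hut) ht) hcont
    rw [Real.coe_toNNReal u hu0.le] at h3
    refine h3.congr_deriv ?_
    rw [direction, neg_one_pow_eq_evenInd, mul_one, hN]
  · exact ((hI.const_mul 2).sub intervalIntegrable_const).const_mul _

omit [IsProbabilityMeasure P] in
theorem IsTelegraphProcess.indep_evenTime (hZ : IsTelegraphProcess P 1 lam T D₀ N Z)
    (hN' : IsRegularPoissonProcess P N' lam) (hNN' : ∀ᵐ ω ∂P, ∀ t, N' t ω = N t ω) (t : ℝ≥0) :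
    IndepFun D₀ (fun ω => evenTime N' t ω) P := by
  have h1 : IndepFun D₀ (fun ω t => N' t ω) P := by
    refine hZ.indep.congr .rfl ?_
    filter_upwards [hNN'] with ω h
    exact funext fun t => (h t).symm
  rw [IndepFun_iff_Indep] at h1 ⊢
  refine indep_of_indep_of_le_right h1 (le_trans (measurable_iff_comap_le.1 ?_)
    (iSup₂_le fun n k => measurable_iff_comap_le.1 ?_ : dyadicPast N' t ≤ _))
  · exact @measurable_evenTime_of_dyadic Ω (dyadicPast N' t) N' t (measurable_dyadicPast N' t)
      hN'.rightCont
  · exact (measurable_pi_apply (dyadicTime t n k)).comp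
      (comap_measurable fun ω (t : ℝ≥0) => N' t ω)

theorem IsTelegraphProcess.measure_mem (hZ : IsTelegraphProcess P 1 lam T D₀ N Z)
    {t : ℝ≥0} (ht : (t : ℝ≥0∞) < T) :
    ∃ ρ : Measure ℝ, ρ = ENNReal.ofReal (Real.exp (-(lam * t))) • Measure.dirac (t : ℝ) +
      (volume.restrict (Icc (0 : ℝ) t)).withDensity
        (fun r => ENNReal.ofReal (evenTimeDensity lam t r)) ∧
    ∀ A, MeasurableSet A → P {ω | Z t ω ∈ A} =
      1 / 2 * ρ {r | 2 * r - t ∈ A} + 1 / 2 * ρ {r | t - 2 * r ∈ A} := by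
  obtain ⟨N', hN', hNN'⟩ := hZ.poisson.exists_regular
  refine ⟨_, rfl, fun A hA => ?_⟩
  have hR := measurable_evenTime hN'.measurable hN'.rightCont t
  rw [← hN'.map_evenTime t]
  have hD1 : MeasurableSet {ω | D₀ ω = 1} := hZ.measurable_dir (measurableSet_singleton 1)
  have hD2 : MeasurableSet {ω | D₀ ω = -1} := hZ.measurable_dir (measurableSet_singleton (-1))
  have hA1 : MeasurableSet {r : ℝ | 2 * r - t ∈ A} :=
    (by fun_prop : Measurable fun r : ℝ => 2 * r - t) hA
  have hA2 : MeasurableSet {r : ℝ | t - 2 * r ∈ A} :=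
    (by fun_prop : Measurable fun r : ℝ => t - 2 * r) hA
  have hdisj : Disjoint {ω | D₀ ω = 1} {ω | D₀ ω = -1} := Set.disjoint_left.2 fun ω h1 h2 => by
    rw [mem_ofPred_eq] at h1 h2
    norm_num [h1] at h2
  have hDae : ∀ᵐ ω ∂P, D₀ ω = 1 ∨ D₀ ω = -1 := by
    have h1 : P ({ω | D₀ ω = 1} ∪ {ω | D₀ ω = -1}) = 1 := by
      rw [measure_union hdisj hD2, hZ.dir_right, hZ.dir_left, ENNReal.add_halves]
    exact (prob_compl_eq_zero_iff (hD1.union hD2)).2 h1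
  have hind := hZ.indep_evenTime hN' hNN' t
  have e1 := hind.measure_inter_preimage_eq_mul {1} _ (measurableSet_singleton 1) hA1
  have e2 := hind.measure_inter_preimage_eq_mul {-1} _ (measurableSet_singleton (-1)) hA2
  rw [show D₀ ⁻¹' {1} = {ω | D₀ ω = 1} from rfl, hZ.dir_right, ← Measure.map_apply hR hA1] at e1
  rw [show D₀ ⁻¹' {-1} = {ω | D₀ ω = -1} from rfl, hZ.dir_left, ← Measure.map_apply hR hA2] at e2
  rw [← e1, ← e2, ← measure_union (hdisj.mono inter_subset_left inter_subset_left)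
    (hD2.inter (hR hA2))]
  refine measure_congr ?_
  filter_upwards [hDae, hZ.ae_eq_evenTime hN' hNN' ht] with ω hD hZω
  refine propext ?_
  change Z t ω ∈ A ↔ (D₀ ω = 1 ∧ 2 * evenTime N' t ω - t ∈ A) ∨
    (D₀ ω = -1 ∧ t - 2 * evenTime N' t ω ∈ A)
  rw [hZω]
  rcases hD with h | h
  · norm_num [h]
  · norm_num [h]

theorem telegraphDensity_eq_evenTimeDensity (lam z t : ℝ) : telegraphDensity lam z t =
    1 / 2 * (1 / 2 * evenTimeDensity lam t ((t + z) / 2)) +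
      1 / 2 * (1 / 2 * evenTimeDensity lam t ((t - z) / 2)) := by
  rw [telegraphDensity, evenTimeDensity, evenTimeDensity,
    show lam ^ 2 * ((t + z) / 2 * (t - (t + z) / 2)) = lam ^ 2 * (t ^ 2 - z ^ 2) / 4 by ring,
    show lam ^ 2 * ((t - z) / 2 * (t - (t - z) / 2)) = lam ^ 2 * (t ^ 2 - z ^ 2) / 4 by ring,
    neg_mul]
  ring

theorem evenTimeDensity_nonneg {lam t r : ℝ} (hlam : 0 ≤ lam) (hr : r ∈ Icc 0 t) :
    0 ≤ evenTimeDensity lam t r :=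
  (hasSum_evenTimeTerm lam t r).nonneg fun n => evenTimeTerm_nonneg hlam hr n

theorem measurable_evenTimeDensity (lam t : ℝ) : Measurable (evenTimeDensity lam t) := by
  have h0 := (continuous_besselSeries 0).measurable
  have h1 := (continuous_besselSeries 1).measurable
  unfold evenTimeDensity
  fun_prop

/-- Off the two atoms, the law of the telegraph process has density `telegraphDensity`. -/
theorem IsTelegraphProcess.measure_mem_of_notMem (hZ : IsTelegraphProcess P 1 lam T D₀ N Z)
    {t : ℝ≥0} (ht : (t : ℝ≥0∞) < T) {A : Set ℝ} (hA : MeasurableSet A) (hA1 : (t : ℝ) ∉ A)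
    (hA2 : (-t : ℝ) ∉ A) :
    P {ω | Z t ω ∈ A} =
      ∫⁻ z in A ∩ Ioo (-t : ℝ) t, ENNReal.ofReal (telegraphDensity lam z t) := by
  obtain ⟨ρ, hρ, h⟩ := hZ.measure_mem ht
  have hAI : A ∩ Ioo (-t : ℝ) t = A ∩ Icc (-t : ℝ) t := by
    ext z
    refine and_congr_right fun hz => ⟨fun h => Ioo_subset_Icc_self h, fun h => ?_⟩
    exact ⟨lt_of_le_of_ne h.1 fun e => hA2 (e ▸ hz), lt_of_le_of_ne h.2 fun e => hA1 (e ▸ hz)⟩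
  have hS : MeasurableSet (A ∩ Icc (-t : ℝ) t) := hA.inter measurableSet_Icc
  have key : ∀ (ε : ℝ) (ψ : ℝ → ℝ), (ε = 1 ∨ ε = -1) → MeasurableSet {r | ψ r ∈ A} →
      (∀ r, ψ r = ε * (2 * r - t)) →
      ρ {r | ψ r ∈ A} = ∫⁻ z in A ∩ Icc (-t : ℝ) t,
        ENNReal.ofReal (1 / 2 * evenTimeDensity lam t ((t + ε * z) / 2)) := by
    intro ε ψ hε hψA hψ
    have ht' : (t : ℝ) ∉ {r | ψ r ∈ A} := by
      rw [mem_ofPred_eq, hψ]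
      rcases hε with rfl | rfl
      · rwa [show (1 : ℝ) * (2 * t - t) = t by ring]
      · rwa [show (-1 : ℝ) * (2 * t - t) = -t by ring]
    have hε2 : ε * ε = 1 := by rcases hε with rfl | rfl <;> norm_num
    have himg : (fun z : ℝ => (t + ε * z) / 2) '' (A ∩ Icc (-t : ℝ) t) =
        {r | ψ r ∈ A} ∩ Icc (0 : ℝ) t := by
      ext r
      constructor
      · rintro ⟨z, ⟨hz, hz1, hz2⟩, rfl⟩
        refine ⟨?_, ?_⟩
        · rw [mem_ofPred_eq, hψ]
          convert hz using 1
          linear_combination z * hε2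
        · rcases hε with rfl | rfl <;> constructor <;> dsimp only <;> linarith
      · rintro ⟨hr, hr1, hr2⟩
        refine ⟨ψ r, ⟨hr, ?_⟩, ?_⟩
        · rw [hψ]
          rcases hε with rfl | rfl <;> constructor <;> linarith
        · dsimp only
          rw [hψ]
          linear_combination (2 * r - t) / 2 * hε2
    rw [hρ, Measure.add_apply, Measure.smul_apply, Measure.dirac_apply' _ hψA,
      indicator_of_notMem ht', smul_zero, zero_add, withDensity_apply _ hψA,
      Measure.restrict_restrict hψA, ← himg,
      lintegral_image_eq_lintegral_abs_deriv_mul (f' := fun _ => ε / 2) hS (fun z _ => ?_) ?_]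
    · refine lintegral_congr fun z => ?_
      rw [ENNReal.ofReal_mul (by norm_num)]
      congr 2
      rcases hε with rfl | rfl <;> norm_num [abs_of_neg]
    · intro a _ b _ hab
      have : ε * a = ε * b := by
        have : (t + ε * a) / 2 = (t + ε * b) / 2 := hab
        linarith
      linear_combination ε * this + (b - a) * hε2
    · have := (((hasDerivAt_id z).const_mul ε).const_add (t : ℝ)).div_const 2
      simpa using this.hasDerivWithinAt
  rw [h A hA, key 1 (fun r => 2 * r - t) (.inl rfl)
      ((by fun_prop : Measurable fun r : ℝ => 2 * r - t) hA) (fun r => by ring),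
    key (-1) (fun r => t - 2 * r) (.inr rfl)
      ((by fun_prop : Measurable fun r : ℝ => t - 2 * r) hA) (fun r => by ring), hAI]
  have hm : ∀ ε : ℝ, Measurable fun z : ℝ =>
      ENNReal.ofReal (1 / 2 * evenTimeDensity lam t ((t + ε * z) / 2)) := fun ε => by
    have := measurable_evenTimeDensity lam t
    fun_prop
  rw [← lintegral_const_mul _ (hm 1), ← lintegral_const_mul _ (hm (-1)),
    ← lintegral_add_left ((hm 1).const_mul _)]
  refine setLIntegral_congr_fun hS fun z hz => ?_
  have h1 : 0 ≤ evenTimeDensity lam t ((t + z) / 2) :=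
    evenTimeDensity_nonneg lam.coe_nonneg ⟨by linarith [hz.2.1], by linarith [hz.2.2]⟩
  have h2 : 0 ≤ evenTimeDensity lam t ((t - z) / 2) :=
    evenTimeDensity_nonneg lam.coe_nonneg ⟨by linarith [hz.2.2], by linarith [hz.2.1]⟩
  have e : (1 / 2 : ℝ≥0∞) = ENNReal.ofReal (1 / 2) := by
    rw [ENNReal.ofReal_div_of_pos two_pos]; simp
  simp only [one_mul, neg_mul, ← sub_eq_add_neg]
  rw [e, ← ENNReal.ofReal_mul (by norm_num), ← ENNReal.ofReal_mul (by norm_num),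
    ← ENNReal.ofReal_add (by positivity) (by positivity), telegraphDensity_eq_evenTimeDensity]

theorem IsTelegraphProcess.measure_pos_of_mem (hZ : IsTelegraphProcess P 1 lam T D₀ N Z)
    {t : ℝ≥0} (ht : (t : ℝ≥0∞) < T) {A : Set ℝ} (hA : MeasurableSet A)
    (h : (t : ℝ) ∈ A ∨ (-t : ℝ) ∈ A) : P {ω | Z t ω ∈ A} ≠ 0 := by
  obtain ⟨ρ, hρ, hP⟩ := hZ.measure_mem ht
  have key : ∀ B : Set ℝ, MeasurableSet B → (t : ℝ) ∈ B → 1 / 2 * ρ B ≠ 0 := by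
    intro B hB htB
    rw [hρ, Measure.add_apply, Measure.smul_apply, Measure.dirac_apply' _ hB,
      indicator_of_mem htB]
    have := Real.exp_pos (-(lam * t))
    simp [this]
  rw [hP A hA]
  rcases h with h | h
  · refine fun h0 => key _ ?_ ?_ (add_eq_zero.1 h0).1
    · exact (by fun_prop : Measurable fun r : ℝ => 2 * r - t) hA
    · rwa [mem_ofPred_eq, show (2 * t - t : ℝ) = t by ring]
  · refine fun h0 => key _ ?_ ?_ (add_eq_zero.1 h0).2
    · exact (by fun_prop : Measurable fun r : ℝ => t - 2 * r) hA
    · rwa [mem_ofPred_eq, show (t - 2 * t : ℝ) = -t by ring]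

end Telegraph

/-- The time needed to travel from `x₀` to `x` with velocity `v`. -/
noncomputable def travelTime (v : ℝ → ℝ) (x₀ x : ℝ) : ℝ := ∫ w in x₀..x, 1 / v w

section TravelTime
variable {I : Set ℝ} {v : ℝ → ℝ} {x₀ : ℝ}

theorem hasDerivAt_travelTime (hI_open : IsOpen I) (hI_conn : I.OrdConnected)
    (hv : ContinuousOn v I) (hv_pos : ∀ x ∈ I, 0 < v x) (hx₀ : x₀ ∈ I) {x : ℝ} (hx : x ∈ I) :
    HasDerivAt (travelTime v x₀) (1 / v x) x := by
  have hc : ContinuousOn (fun w => 1 / v w) I :=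
    continuousOn_const.div hv fun x hx => (hv_pos x hx).ne'
  exact intervalIntegral.integral_hasDerivAt_right
    (hc.mono (hI_conn.uIcc_subset hx₀ hx)).intervalIntegrable
    (hc.stronglyMeasurableAtFilter hI_open x hx) (hc.continuousAt (hI_open.mem_nhds hx))

theorem continuousOn_travelTime (hI_open : IsOpen I) (hI_conn : I.OrdConnected)
    (hv : ContinuousOn v I) (hv_pos : ∀ x ∈ I, 0 < v x) (hx₀ : x₀ ∈ I) :
    ContinuousOn (travelTime v x₀) I := fun _ hx =>
  (hasDerivAt_travelTime hI_open hI_conn hv hv_pos hx₀ hx).continuousAt.continuousWithinAt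

theorem strictMonoOn_travelTime (hI_open : IsOpen I) (hI_conn : I.OrdConnected)
    (hv : ContinuousOn v I) (hv_pos : ∀ x ∈ I, 0 < v x) (hx₀ : x₀ ∈ I) :
    StrictMonoOn (travelTime v x₀) I := by
  refine strictMonoOn_of_deriv_pos hI_conn.convex
    (continuousOn_travelTime hI_open hI_conn hv hv_pos hx₀) fun x hx => ?_
  have hx := interior_subset hx
  rw [(hasDerivAt_travelTime hI_open hI_conn hv hv_pos hx₀ hx).deriv]
  exact one_div_pos.2 (hv_pos x hx)

end TravelTime

/-- The travel time of the motion with velocity `v`, scaled by `c`, is a telegraph process. -/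
theorem IsSpaceVaryingMotion.isTelegraphProcess {Ω : Type*} [MeasurableSpace Ω] {P : Measure Ω}
    {I : Set ℝ} (hI_open : IsOpen I) (hI_conn : I.OrdConnected) {v : ℝ → ℝ}
    (hv : ContinuousOn v I) (hv_pos : ∀ x ∈ I, 0 < v x) {lam : ℝ≥0} {x₀ : ℝ} (hx₀ : x₀ ∈ I)
    {T : ℝ≥0∞} {D₀ : Ω → ℝ} {N : ℝ≥0 → Ω → ℕ} {X : ℝ≥0 → Ω → ℝ}
    (hX : IsSpaceVaryingMotion P I v lam x₀ T D₀ N X) (c : ℝ) :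
    IsTelegraphProcess P c lam T D₀ N (fun t ω => c * travelTime v x₀ (X t ω)) where
  measurable_dir := hX.measurable_dir
  dir_right := hX.dir_right
  dir_left := hX.dir_left
  poisson := hX.poisson
  indep := hX.indep
  aemeasurable t ht := by
    have hmem : ∀ᵐ x ∂(P.map (X t)), x ∈ I := by
      refine (ae_map_iff (p := fun x => x ∈ I) (hX.aemeasurable t ht) hI_open.measurableSet).2 ?_
      filter_upwards [hX.mem_space] with ω h using h t ht
    have h := (continuousOn_travelTime hI_open hI_conn hv hv_pos hx₀).aemeasurable
      (μ := P.map (X t)) hI_open.measurableSet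
    rw [Measure.restrict_eq_self_of_ae_mem hmem] at h
    exact (h.comp_aemeasurable (hX.aemeasurable t ht)).const_mul c
  start := by
    filter_upwards [hX.start] with ω h
    simp [h, travelTime]
  mem_space := .of_forall fun _ _ _ => mem_univ _
  continuous_paths := by
    filter_upwards [hX.continuous_paths, hX.mem_space] with ω hc hmem
    exact continuousOn_const.mul
      ((continuousOn_travelTime hI_open hI_conn hv hv_pos hx₀).comp hc fun t ht => hmem t ht)
  velocity := by
    filter_upwards [hX.velocity, hX.mem_space] with ω hvel hmem t ht htT hcont
    have hxI := hmem t htT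
    have h1 := hasDerivAt_travelTime hI_open hI_conn hv hv_pos hx₀ hxI
    have h2 := hvel t ht htT hcont
    have h1' : HasDerivAt (travelTime v x₀) (1 / v (X t ω)) (X (t : ℝ).toNNReal ω) := by
      rwa [Real.toNNReal_coe]
    have h3 := (h1'.comp (t : ℝ) h2).const_mul c
    refine h3.congr_deriv ?_
    have := (hv_pos _ hxI).ne'
    field_simp

theorem SolvesVelocityPDEAt.congr {v : ℝ → ℝ} {lam : ℝ} {f g : ℝ → ℝ → ℝ} {x t : ℝ}
    (hg : SolvesVelocityPDEAt v lam g x t) (ht : (fun s => f x s) =ᶠ[𝓝 t] fun s => g x s)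
    (hx : (fun y => f y t) =ᶠ[𝓝 x] fun y => g y t) : SolvesVelocityPDEAt v lam f x t := by
  have h1 : (fun y => v y * f y t) =ᶠ[𝓝 x] fun y => v y * g y t := hx.mono fun y hy => by
    simp only [hy]
  have h2 : (fun y => v y * deriv (fun z => v z * f z t) y) =ᶠ[𝓝 x]
      fun y => v y * deriv (fun z => v z * g z t) y := h1.deriv.mono fun y hy => by
    simp only [hy]
  refine ⟨hg.diff_t.congr_of_eventuallyEq ht, hg.diff_tt.congr_of_eventuallyEq ht.deriv,
    hg.diff_x.congr_of_eventuallyEq h1, hg.diff_xx.congr_of_eventuallyEq h2, ?_⟩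
  rw [ht.deriv.deriv_eq, ht.deriv_eq, h2.deriv_eq]
  exact hg.eqn

theorem solvesVelocityPDEAt_zero (v : ℝ → ℝ) (lam x t : ℝ) :
    SolvesVelocityPDEAt v lam (fun _ _ => 0) x t := by
  constructor <;> simp

theorem solvesVelocityPDEAt_telegraphDensity {I : Set ℝ} (hI_open : IsOpen I)
    (hI_conn : I.OrdConnected) {v : ℝ → ℝ} (hv : ContinuousOn v I) (hv_pos : ∀ x ∈ I, 0 < v x)
    {x₀ : ℝ} (hx₀ : x₀ ∈ I) (lam : ℝ) {x : ℝ} (hx : x ∈ I) (t : ℝ) :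
    SolvesVelocityPDEAt v lam (fun y s => telegraphDensity lam (travelTime v x₀ y) s / v y) x t := by
  have hI : ∀ᶠ y in 𝓝 x, y ∈ I := hI_open.mem_nhds hx
  have hd := fun y hy => hasDerivAt_travelTime hI_open hI_conn hv hv_pos hx₀ (x := y) hy
  have ht : ∀ s, HasDerivAt (fun s => telegraphDensity lam (travelTime v x₀ x) s / v x)
      (telegraphDensityT lam (travelTime v x₀ x) s / v x) s := fun s =>
    (hasDerivAt_telegraphDensity_time _ _ _).div_const _
  have htt : HasDerivAt (fun s => telegraphDensityT lam (travelTime v x₀ x) s / v x)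
      (telegraphDensityTT lam (travelTime v x₀ x) t / v x) t :=
    (hasDerivAt_telegraphDensityT _ _ _).div_const _
  have e1 : deriv (fun s => telegraphDensity lam (travelTime v x₀ x) s / v x) =
      fun s => telegraphDensityT lam (travelTime v x₀ x) s / v x := funext fun s => (ht s).deriv
  have hvf : ∀ y ∈ I, v y * (telegraphDensity lam (travelTime v x₀ y) t / v y) =
      telegraphDensity lam (travelTime v x₀ y) t := fun y hy => mul_div_cancel₀ _ (hv_pos y hy).ne'
  have hxd : ∀ y ∈ I, HasDerivAt
      (fun y => v y * (telegraphDensity lam (travelTime v x₀ y) t / v y))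
      (telegraphDensityZ lam (travelTime v x₀ y) t * (1 / v y)) y := fun y hy =>
    ((hasDerivAt_telegraphDensity_space lam (travelTime v x₀ y) t).comp y
      (hd y hy)).congr_of_eventuallyEq (Filter.Eventually.mono (hI_open.mem_nhds hy) hvf)
  have e2 : (fun y => v y *
      deriv (fun z => v z * (telegraphDensity lam (travelTime v x₀ z) t / v z)) y) =ᶠ[𝓝 x]
      fun y => telegraphDensityZ lam (travelTime v x₀ y) t := by
    filter_upwards [hI] with y hy
    have := (hv_pos y hy).ne'
    rw [(hxd y hy).deriv]
    field_simp
  have hxx : HasDerivAt (fun y => v y *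
      deriv (fun z => v z * (telegraphDensity lam (travelTime v x₀ z) t / v z)) y)
      (telegraphDensityZZ lam (travelTime v x₀ x) t * (1 / v x)) x :=
    ((hasDerivAt_telegraphDensityZ lam (travelTime v x₀ x) t).comp x
      (hd x hx)).congr_of_eventuallyEq e2
  refine ⟨(ht t).differentiableAt, ?_, (hxd x hx).differentiableAt, hxx.differentiableAt, ?_⟩
  · rw [e1]
    exact htt.differentiableAt
  · rw [hxx.deriv, e1, htt.deriv, ← telegraph_equation]
    ring

open Classical in
/-- The density of the motion with velocity `v` in `I`, off the boundary of its range. -/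
noncomputable def motionDensity (I : Set ℝ) (v : ℝ → ℝ) (x₀ lam x t : ℝ) : ℝ :=
  if x ∈ I ∧ |travelTime v x₀ x| < t then telegraphDensity lam (travelTime v x₀ x) t / v x else 0

section Density
variable {Ω : Type*} [MeasurableSpace Ω] {P : Measure Ω} [IsProbabilityMeasure P]
  {I : Set ℝ} {v : ℝ → ℝ} {lam : ℝ≥0} {x₀ : ℝ}
  {T : ℝ≥0∞} {D₀ : Ω → ℝ} {N : ℝ≥0 → Ω → ℕ} {X : ℝ≥0 → Ω → ℝ}

omit [IsProbabilityMeasure P] in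
theorem IsSpaceVaryingMotion.isTelegraphProcess_one (hI_open : IsOpen I)
    (hI_conn : I.OrdConnected) (hv : ContinuousOn v I) (hv_pos : ∀ x ∈ I, 0 < v x) (hx₀ : x₀ ∈ I)
    (hX : IsSpaceVaryingMotion P I v lam x₀ T D₀ N X) :
    IsTelegraphProcess P 1 lam T D₀ N (fun t ω => travelTime v x₀ (X t ω)) := by
  simpa only [one_mul] using hX.isTelegraphProcess hI_open hI_conn hv hv_pos hx₀ 1

/-- Every point that can be reached in time `t < T` lies in `I`. -/
theorem IsSpaceVaryingMotion.exists_travelTime_eq (hI_open : IsOpen I) (hI_conn : I.OrdConnected)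
    (hv : ContinuousOn v I) (hv_pos : ∀ x ∈ I, 0 < v x) (hx₀ : x₀ ∈ I)
    (hX : IsSpaceVaryingMotion P I v lam x₀ T D₀ N X) {t : ℝ≥0} (htT : (t : ℝ≥0∞) < T)
    {z : ℝ} (hz : z = t ∨ z = -t) : ∃ b ∈ I, travelTime v x₀ b = z := by
  by_contra! h
  refine (hX.isTelegraphProcess_one hI_open hI_conn hv hv_pos hx₀).measure_pos_of_mem htT
    (measurableSet_singleton z) (hz.imp Eq.symm Eq.symm) ?_
  rw [measure_eq_zero_iff_ae_notMem]
  filter_upwards [hX.mem_space] with ω hmem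
  exact h _ (hmem t htT)

/-- Off the extreme points `a` and `b`, the law of the motion has density `motionDensity`. -/
theorem IsSpaceVaryingMotion.map_apply_of_notMem (hI_open : IsOpen I) (hI_conn : I.OrdConnected)
    (hv : ContinuousOn v I) (hv_pos : ∀ x ∈ I, 0 < v x) (hx₀ : x₀ ∈ I)
    (hX : IsSpaceVaryingMotion P I v lam x₀ T D₀ N X) {t : ℝ≥0} (htT : (t : ℝ≥0∞) < T)
    {A : Set ℝ} (hA : MeasurableSet A) (hAF : ∀ x ∈ A, x ∈ I → |travelTime v x₀ x| ≠ t) :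
    P.map (X t) A = ∫⁻ x in A, ENNReal.ofReal (motionDensity I v x₀ lam x t) := by
  have hinj := (strictMonoOn_travelTime hI_open hI_conn hv hv_pos hx₀).injOn
  have hcont := continuousOn_travelTime hI_open hI_conn hv hv_pos hx₀
  have hJ : MeasurableSet {x | x ∈ I ∧ |travelTime v x₀ x| < t} :=
    (hcont.abs.isOpen_inter_preimage hI_open isOpen_Iio).measurableSet
  have hAI : MeasurableSet (A ∩ I) := hA.inter hI_open.measurableSet
  have habs : |(t : ℝ)| = t := abs_of_nonneg t.coe_nonneg
  have h1 : P.map (X t) A = P {ω | travelTime v x₀ (X t ω) ∈ travelTime v x₀ '' (A ∩ I)} := by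
    rw [Measure.map_apply_of_aemeasurable (hX.aemeasurable t htT) hA]
    refine measure_congr ?_
    filter_upwards [hX.mem_space] with ω hmem
    refine propext ⟨fun h => ⟨_, ⟨h, hmem t htT⟩, rfl⟩, ?_⟩
    rintro ⟨x, ⟨hxA, hxI⟩, hx⟩
    rw [hinj hxI (hmem t htT) hx] at hxA
    exact hxA
  have h2 : travelTime v x₀ '' (A ∩ I) ∩ Ioo (-t : ℝ) t =
      travelTime v x₀ '' (A ∩ {x | x ∈ I ∧ |travelTime v x₀ x| < t}) := by
    ext z
    constructor
    · rintro ⟨⟨x, ⟨hxA, hxI⟩, rfl⟩, hz⟩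
      exact ⟨x, ⟨hxA, hxI, abs_lt.2 hz⟩, rfl⟩
    · rintro ⟨x, ⟨hxA, hxI, hz⟩, rfl⟩
      exact ⟨⟨x, ⟨hxA, hxI⟩, rfl⟩, abs_lt.1 hz⟩
  rw [h1, (hX.isTelegraphProcess_one hI_open hI_conn hv hv_pos hx₀).measure_mem_of_notMem htT
    (hAI.image_of_continuousOn_injOn (hcont.mono inter_subset_right)
      (hinj.mono inter_subset_right)) ?_ ?_, h2,
    lintegral_image_eq_lintegral_abs_deriv_mul (f' := fun x => 1 / v x) (hA.inter hJ)
      (fun x hx => (hasDerivAt_travelTime hI_open hI_conn hv hv_pos hx₀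
        hx.2.1).hasDerivWithinAt) (hinj.mono fun x hx => hx.2.1)]
  · have e : (fun x => ENNReal.ofReal (motionDensity I v x₀ lam x t)) =
        {x | x ∈ I ∧ |travelTime v x₀ x| < t}.indicator fun x =>
          ENNReal.ofReal (telegraphDensity lam (travelTime v x₀ x) t / v x) := by
      ext x
      by_cases hx : x ∈ I ∧ |travelTime v x₀ x| < t
      · rw [indicator_of_mem (by exact hx), motionDensity, if_pos hx]
      · rw [indicator_of_notMem (by exact hx), motionDensity, if_neg hx, ENNReal.ofReal_zero]
    rw [e, setLIntegral_indicator hJ, inter_comm]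
    refine setLIntegral_congr_fun (hJ.inter hA) fun x hx => ?_
    have hvx : 0 < 1 / v x := one_div_pos.2 (hv_pos x hx.1.1)
    rw [abs_of_pos hvx, ← ENNReal.ofReal_mul hvx.le, one_div_mul_eq_div]
  · rintro ⟨x, ⟨hxA, hxI⟩, hx⟩
    exact hAF x hxA hxI (by rw [hx, habs])
  · rintro ⟨x, ⟨hxA, hxI⟩, hx⟩
    exact hAF x hxA hxI (by rw [hx, abs_neg, habs])

/-- The boundary of the support at time `t` is the set of points whose travel time is `t`. -/
theorem IsSpaceVaryingMotion.frontier_supportAt (hI_open : IsOpen I)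
    (hI_conn : I.OrdConnected) (hv : ContinuousOn v I) (hv_pos : ∀ x ∈ I, 0 < v x) (hx₀ : x₀ ∈ I)
    (hlam : 0 < lam) (hX : IsSpaceVaryingMotion P I v lam x₀ T D₀ N X) {t : ℝ≥0} (ht : 0 < t)
    (htT : (t : ℝ≥0∞) < T) :
    frontier (supportAt P X t) = {x | x ∈ I ∧ |travelTime v x₀ x| = t} ∧
      IsClosed {x | x ∈ I ∧ |travelTime v x₀ x| ≤ t} := by
  have ht' : (0 : ℝ) < t := ht
  have hmono := strictMonoOn_travelTime hI_open hI_conn hv hv_pos hx₀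
  have hcont := continuousOn_travelTime hI_open hI_conn hv hv_pos hx₀
  obtain ⟨a, ha, hat⟩ := hX.exists_travelTime_eq hI_open hI_conn hv hv_pos hx₀ htT (.inr rfl)
  obtain ⟨b, hb, hbt⟩ := hX.exists_travelTime_eq hI_open hI_conn hv hv_pos hx₀ htT (.inl rfl)
  have hab : a < b := (hmono.lt_iff_lt ha hb).1 (by rw [hat, hbt]; linarith)
  have hle : {x | x ∈ I ∧ |travelTime v x₀ x| ≤ t} = Icc a b := by
    ext x
    constructor
    · rintro ⟨hx, hxt⟩
      rw [abs_le, ← hat, ← hbt, hmono.le_iff_le ha hx, hmono.le_iff_le hx hb] at hxt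
      exact hxt
    · intro hx
      have hxI := hI_conn.out ha hb hx
      refine ⟨hxI, ?_⟩
      rw [abs_le, ← hat, ← hbt, hmono.le_iff_le ha hxI, hmono.le_iff_le hxI hb]
      exact hx
  have heq : {x | x ∈ I ∧ |travelTime v x₀ x| = t} = {a, b} := by
    ext x
    constructor
    · rintro ⟨hx, hxt⟩
      rcases (abs_eq ht'.le).1 hxt with h | h
      · exact .inr (hmono.injOn hx hb (h.trans hbt.symm))
      · exact .inl (hmono.injOn hx ha (h.trans hat.symm))
    · rintro (rfl | rfl)
      · exact ⟨ha, by rw [hat, abs_neg, abs_of_pos ht']⟩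
      · exact ⟨hb, by rw [hbt, abs_of_pos ht']⟩
  have hlt : ∀ x ∈ Ioo a b, x ∈ I ∧ |travelTime v x₀ x| < t := by
    intro x hx
    have h := hle.ge (Ioo_subset_Icc_self hx)
    refine ⟨h.1, lt_of_le_of_ne h.2 fun h' => ?_⟩
    have : x ∈ ({a, b} : Set ℝ) := heq.le ⟨h.1, h'⟩
    rcases this with rfl | rfl
    · exact hx.1.false
    · exact hx.2.false
  refine ⟨?_, hle ▸ isClosed_Icc⟩
  have hsupp : supportAt P X t = Icc a b := by
    refine Subset.antisymm (Measure.support_subset_of_isClosed isClosed_Icc ?_) ?_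
    · change P.map (X t) (Icc a b)ᶜ = 0
      rw [hX.map_apply_of_notMem hI_open hI_conn hv hv_pos hx₀ htT measurableSet_Icc.compl]
      · refine (setLIntegral_congr_fun measurableSet_Icc.compl fun x hx => ?_).trans
          (lintegral_zero (μ := volume.restrict (Icc a b)ᶜ))
        rw [motionDensity, if_neg fun h => hx (hle.le ⟨h.1, h.2.le⟩), ENNReal.ofReal_zero]
      · exact fun x hx hxI h => hx (hle.le ⟨hxI, h.le⟩)
    · rw [← closure_Ioo hab.ne]
      refine closure_minimal (fun x hx => ?_) Measure.isClosed_support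
      refine (Measure.mem_support_iff_forall x).2 ?_
      intro U hU
      obtain ⟨V, hVU, hVo, hxV⟩ := mem_nhds_iff.1 (inter_mem hU (Ioo_mem_nhds hx.1 hx.2))
      refine lt_of_lt_of_le (pos_iff_ne_zero.2 fun h0 => ?_)
        (measure_mono (hVU.trans inter_subset_left))
      have hV := fun y hy => hlt y (hVU hy).2
      have hVI : V ⊆ I := fun y hy => (hV y hy).1
      rw [hX.map_apply_of_notMem hI_open hI_conn hv hv_pos hx₀ htT hVo.measurableSet
        fun y hy _ => (hV y hy).2.ne] at h0
      have hc : ContinuousOn (fun x => telegraphDensity lam (travelTime v x₀ x) t / v x) V :=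
        ((continuous_telegraphDensity lam t).comp_continuousOn (hcont.mono hVI)).div
          (hv.mono hVI) fun y hy => (hv_pos y (hVI hy)).ne'
      rw [setLIntegral_congr_fun hVo.measurableSet (g := fun x =>
        ENNReal.ofReal (telegraphDensity lam (travelTime v x₀ x) t / v x)) fun y hy => by
          simp only [motionDensity, if_pos (hV y hy)], lintegral_eq_zero_iff'
        (hc.aemeasurable hVo.measurableSet).ennreal_ofReal] at h0
      have hfalse : ∀ᵐ y ∂(volume.restrict V), y ∉ V := by
        filter_upwards [h0] with y hy hyV
        have h1 := telegraphDensity_pos (lam := lam) hlam ht' (hV y hyV).2.le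
        have h2 := div_pos h1 (hv_pos y (hVI hyV))
        exact (ENNReal.ofReal_pos.2 h2).ne' hy
      have : volume V = 0 := by
        rw [← Measure.restrict_eq_zero, ← ae_eq_bot]
        exact eventually_false_iff_eq_bot.1
          ((hfalse.and (ae_restrict_mem hVo.measurableSet)).mono fun y hy => hy.1 hy.2)
      exact (hVo.measure_pos volume ⟨x, hxV⟩).ne' this
  rw [hsupp, frontier_Icc hab.le, heq]

/-- Away from the boundary of the range, `motionDensity` is locally either the transformed
telegraph density or zero. -/
theorem motionDensity_eventuallyEq_space (hI_open : IsOpen I) (hI_conn : I.OrdConnected)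
    (hv : ContinuousOn v I) (hv_pos : ∀ x ∈ I, 0 < v x) (hx₀ : x₀ ∈ I) {t x : ℝ}
    (hc : IsClosed {x | x ∈ I ∧ |travelTime v x₀ x| ≤ t})
    (hx : ¬(x ∈ I ∧ |travelTime v x₀ x| = t)) (lam : ℝ) :
    ((x ∈ I ∧ |travelTime v x₀ x| < t) ∧ (fun y => motionDensity I v x₀ lam y t) =ᶠ[𝓝 x]
      fun y => telegraphDensity lam (travelTime v x₀ y) t / v y) ∨
    (¬(x ∈ I ∧ |travelTime v x₀ x| < t) ∧
      (fun y => motionDensity I v x₀ lam y t) =ᶠ[𝓝 x] fun _ => 0) := by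
  by_cases h : x ∈ I ∧ |travelTime v x₀ x| < t
  · refine .inl ⟨h, ?_⟩
    have hopen : IsOpen {x | x ∈ I ∧ |travelTime v x₀ x| < t} :=
      (continuousOn_travelTime hI_open hI_conn hv hv_pos hx₀).abs.isOpen_inter_preimage hI_open
        isOpen_Iio
    filter_upwards [hopen.mem_nhds h] with y hy
    rw [motionDensity, if_pos hy]
  · refine .inr ⟨h, ?_⟩
    have hx' : x ∉ {x | x ∈ I ∧ |travelTime v x₀ x| ≤ t} := fun h' =>
      h'.2.lt_or_eq.elim (fun h1 => h ⟨h'.1, h1⟩) fun h1 => hx ⟨h'.1, h1⟩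
    filter_upwards [hc.isOpen_compl.mem_nhds hx'] with y hy
    rw [motionDensity, if_neg fun h => hy ⟨h.1, h.2.le⟩]

theorem IsSpaceVaryingMotion.isDensityOf (hI_open : IsOpen I)
    (hI_conn : I.OrdConnected) (hv : ContinuousOn v I) (hv_pos : ∀ x ∈ I, 0 < v x) (hx₀ : x₀ ∈ I)
    (hlam : 0 < lam) (hX : IsSpaceVaryingMotion P I v lam x₀ T D₀ N X) :
    IsDensityOf P X T (motionDensity I v x₀ lam) where
  nonneg t ht htT x _ := by
    unfold motionDensity
    split_ifs with h
    · exact (div_pos (telegraphDensity_pos (lam := lam) hlam (by exact_mod_cast ht) h.2.le)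
        (hv_pos x h.1)).le
    · exact le_rfl
  continuousOn t ht htT := by
    obtain ⟨hF, hc⟩ := hX.frontier_supportAt hI_open hI_conn hv hv_pos hx₀ hlam ht htT
    intro x hx
    rw [hF] at hx
    refine ContinuousAt.continuousWithinAt ?_
    rcases motionDensity_eventuallyEq_space hI_open hI_conn hv hv_pos hx₀ hc hx lam with h | h
    · refine ContinuousAt.congr ?_ h.2.symm
      exact ((continuous_telegraphDensity lam t).continuousAt.comp (hasDerivAt_travelTime
        hI_open hI_conn hv hv_pos hx₀ h.1.1).continuousAt).div
        (hv.continuousAt (hI_open.mem_nhds h.1.1)) (hv_pos x h.1.1).ne'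
    · exact continuousAt_const.congr h.2.symm
  law t ht htT := by
    obtain ⟨hF, hc⟩ := hX.frontier_supportAt hI_open hI_conn hv hv_pos hx₀ hlam ht htT
    have hFm : MeasurableSet (frontier (supportAt P X t))ᶜ := isClosed_frontier.measurableSet.compl
    ext A hA
    rw [Measure.restrict_apply hA, withDensity_apply _ hA, Measure.restrict_restrict hA]
    refine hX.map_apply_of_notMem hI_open hI_conn hv hv_pos hx₀ htT (hA.inter hFm) ?_
    exact fun x hx hxI h => hx.2 (hF.ge ⟨hxI, h⟩)

omit [IsProbabilityMeasure P] in
theorem IsDensityOf.eqOn {f g : ℝ → ℝ → ℝ} (hf : IsDensityOf P X T f) (hg : IsDensityOf P X T g)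
    {t : ℝ≥0} (ht : 0 < t) (htT : (t : ℝ≥0∞) < T) :
    EqOn (fun x => f x t) (fun x => g x t) (frontier (supportAt P X t))ᶜ := by
  have hU : IsOpen (frontier (supportAt P X t))ᶜ := isClosed_frontier.isOpen_compl
  have hfc := hf.continuousOn t ht htT
  have hgc := hg.continuousOn t ht htT
  refine Measure.eqOn_open_of_ae_eq (μ := volume) ?_ hU hfc hgc
  have h := (hf.law t ht htT).symm.trans (hg.law t ht htT)
  rw [withDensity_eq_iff_of_sigmaFinite (hfc.aemeasurable hU.measurableSet).ennreal_ofReal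
    (hgc.aemeasurable hU.measurableSet).ennreal_ofReal] at h
  filter_upwards [h, ae_restrict_mem hU.measurableSet] with x hx hxU
  exact (ENNReal.ofReal_eq_ofReal_iff (hf.nonneg t ht htT x hxU) (hg.nonneg t ht htT x hxU)).1 hx

theorem IsSpaceVaryingMotion.solvesVelocityPDEAt (hI_open : IsOpen I)
    (hI_conn : I.OrdConnected) (hv : ContinuousOn v I) (hv_pos : ∀ x ∈ I, 0 < v x) (hx₀ : x₀ ∈ I)
    (hlam : 0 < lam) (hX : IsSpaceVaryingMotion P I v lam x₀ T D₀ N X) {f : ℝ → ℝ → ℝ}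
    (hf : IsDensityOf P X T f) {t : ℝ≥0} (ht : 0 < t) (htT : (t : ℝ≥0∞) < T) {x : ℝ}
    (hx : x ∉ frontier (supportAt P X t)) : SolvesVelocityPDEAt v lam f x t := by
  have hg := hX.isDensityOf hI_open hI_conn hv hv_pos hx₀ hlam
  obtain ⟨hF, hc⟩ := hX.frontier_supportAt hI_open hI_conn hv hv_pos hx₀ hlam ht htT
  have hspace : (fun y => f y t) =ᶠ[𝓝 x] fun y => motionDensity I v x₀ lam y t := by
    filter_upwards [isClosed_frontier.isOpen_compl.mem_nhds hx] with y hy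
      using hf.eqOn hg ht htT hy
  have hx' : ¬(x ∈ I ∧ |travelTime v x₀ x| = t) := fun h => hx (hF.ge h)
  have hpos : ∀ᶠ s : ℝ in 𝓝 (t : ℝ), 0 < s := lt_mem_nhds (by exact_mod_cast ht)
  have hT : ∀ᶠ s : ℝ in 𝓝 (t : ℝ), ENNReal.ofReal s < T :=
    ENNReal.continuous_ofReal.continuousAt.eventually_lt_const (by simpa using htT)
  have htime : ∀ᶠ s : ℝ in 𝓝 (t : ℝ), ¬(x ∈ I ∧ |travelTime v x₀ x| = s) →
      f x s = motionDensity I v x₀ lam x s := by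
    filter_upwards [hpos, hT] with s hs hsT hxs
    lift s to ℝ≥0 using hs.le
    have hs' : 0 < s := by exact_mod_cast hs
    have hsT' : (s : ℝ≥0∞) < T := by simpa using hsT
    refine hf.eqOn hg hs' hsT' ?_
    rw [(hX.frontier_supportAt hI_open hI_conn hv hv_pos hx₀ hlam hs' hsT').1]
    exact hxs
  rcases motionDensity_eventuallyEq_space hI_open hI_conn hv hv_pos hx₀ hc hx' lam with h | h
  · refine (solvesVelocityPDEAt_telegraphDensity hI_open hI_conn hv hv_pos hx₀ lam h.1.1 t).congr
      ?_ (hspace.trans h.2)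
    filter_upwards [htime, lt_mem_nhds h.1.2] with s hs hlt
    rw [hs fun h' => hlt.ne h'.2, motionDensity, if_pos ⟨h.1.1, hlt⟩]
  · refine (solvesVelocityPDEAt_zero v lam x t).congr ?_ (hspace.trans h.2)
    by_cases hxI : x ∈ I
    · have hgt : (t : ℝ) < |travelTime v x₀ x| :=
        lt_of_le_of_ne (not_lt.1 fun h' => h.1 ⟨hxI, h'⟩) fun e => hx' ⟨hxI, e.symm⟩
      filter_upwards [htime, gt_mem_nhds hgt] with s hs hlt
      rw [hs fun h' => hlt.ne' h'.2, motionDensity, if_neg fun h' => lt_asymm hlt h'.2]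
    · filter_upwards [htime] with s hs
      rw [hs fun h' => hxI h'.1, motionDensity, if_neg fun h' => hxI h'.1]

end Density

theorem mainTheorem1 {Ω : Type*} [MeasurableSpace Ω] (P : Measure Ω) [IsProbabilityMeasure P]
    (I : Set ℝ) (hI_open : IsOpen I) (hI_conn : I.OrdConnected)
    (v : ℝ → ℝ) (hv : ContDiffOn ℝ 1 v I) (hv_pos : ∀ x ∈ I, 0 < v x)
    (lam : ℝ≥0) (hlam : 0 < lam) (x₀ : ℝ) (hx₀ : x₀ ∈ I) (T : ℝ≥0∞)
    (D₀ : Ω → ℝ) (N : ℝ≥0 → Ω → ℕ) (X : ℝ≥0 → Ω → ℝ)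
    (hX : IsSpaceVaryingMotion P I v lam x₀ T D₀ N X) :
    (∃ f : ℝ → ℝ → ℝ, IsDensityOf P X T f) ∧
    (∀ f : ℝ → ℝ → ℝ, IsDensityOf P X T f →
      ∀ t : ℝ≥0, 0 < t → (t : ℝ≥0∞) < T → ∀ x ∉ frontier (supportAt P X t),
        SolvesVelocityPDEAt v lam f x t) ∧
    (∀ c : ℝ, 0 < c →
      IsTelegraphProcess P c lam T D₀ N (fun t ω => c * ∫ w in x₀..X t ω, 1 / v w)) :=
  ⟨⟨_, hX.isDensityOf hI_open hI_conn hv.continuousOn hv_pos hx₀ hlam⟩,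
    fun _ hf _ ht htT _ hx =>
      hX.solvesVelocityPDEAt hI_open hI_conn hv.continuousOn hv_pos hx₀ hlam hf ht htT hx,
    fun c _ => hX.isTelegraphProcess hI_open hI_conn hv.continuousOn hv_pos hx₀ c⟩
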